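/- All structures are finite and all vocabularies are finite and relational. $L_{\infty\omega}(C)$ denotes the extension of first-order logic by conjunctions and disjunctions of arbitrary sets of formulas, provided that the total number of variables occurring in the set is finite, and by counting quantifiers "there are at least $m$ elements $x$ such that". A hypergraph is a nonempty set $U$ with a collection of 3-element subsets of $U$ (hyperedges); it is odd if for every nonempty $X\subseteq U$ there is a hyperedge $h$ with $|h\cap X|$ odd. A 4-multipede is a structure $(M,E,T,<,\varepsilon)$ such that: (1) $E$ is a binary relation whose domain (the set of feet) and range (the set of segments) are disjoint; every foot $x$ has exactly one segment $S(x)$ with $xE\,S(x)$, and every segment has exactly two feet. (2) $T$ is a symmetric ternary relation, holding only of triples of pairwise distinct elements, that makes the set $U$ of all feet and segments a hypergraph. Each hyperedge consists of segments only or of feet only, and if $h$ is a foot hyperedge then $S(h)$ is a hyperedge. A slave of a segment hyperedge $X$ is a 3-element set $A$ of feet with $S(A)=X$; it is positive if it is a hyperedge. Each segment hyperedge $X$ has exactly four positive slaves, and any two of them are equal or are obtained from one another by exchanging the two feet of each of two distinct segments of $X$. (3) $<$ is a linear order on the set of segments. (4) The elements of $M$ that are neither feet nor segments (super-segments) represent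 uniquely all sets of segments: $\varepsilon$ holds only between segments and super-segments, and for every set $X$ of segments there is exactly one super-segment $Y$ with $X=\{x : x\,\varepsilon\,Y\}$. A 4-multipede is odd if the hypergraph of its segments (with the segment hyperedges) is odd. **Theorem.** Let $K$ be the class of finite odd 4-multipedes. (a) $K$ is finitely axiomatizable: there is a finite set of first-order sentences whose finite models are exactly the structures in $K$. (b) Every structure in $K$ is rigid, that is, has no nontrivial automorphism. (c) No $L_{\infty\omega}(C)$ formula $\varphi(x,y)$ with two free variables defines a linear order (strict or reflexive) in every structure of $K$; that is, for each $\varphi$ there is $M\in K$ such that $\{(a,b)\in M^2 : M\models\varphi(a,b)\}$ is not a linear order of the set of all elements of $M$. (d) In particular, no formula $\varphi(x,y)$ of the extension of first-order logic by inflationary fixed points defines a linear order in every structure of $K$. This refutes Dawar's conjecture that for every finitely axiomatizable class of rigid structures some fixed-point formula defines a linear order in the class. -/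

import Mathlib

open scoped FirstOrder

universe u w

/-! ## Infinitary logic with counting quantifiers -/

/-- Infinitary formulas with counting quantifiers over a vocabulary `L`; variables are named by
natural numbers. Conjunctions and disjunctions range over arbitrary families of formulas.
`exCount m x φ` is the counting quantifier "there are at least `m` elements `x` with `φ`". -/
inductive InfFormula (L : FirstOrder.Language.{0, 0}) : Type (u + 1)
  | equal (t₁ t₂ : L.Term ℕ) : InfFormula L
  | rel {n : ℕ} (R : L.Relations n) (ts : Fin n → L.Term ℕ) : InfFormula L
  | neg (φ : InfFormula L) : InfFormula L
  | conj {ι : Type u} (φ : ι → InfFormula L) : InfFormula L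
  | disj {ι : Type u} (φ : ι → InfFormula L) : InfFormula L
  | ex (x : ℕ) (φ : InfFormula L) : InfFormula L
  | all (x : ℕ) (φ : InfFormula L) : InfFormula L
  | exCount (m x : ℕ) (φ : InfFormula L) : InfFormula L

namespace InfFormula

variable {L : FirstOrder.Language.{0, 0}}

/-- All variables, free or bound, that occur in a formula. -/
def vars : InfFormula.{u} L → Set ℕ
  | equal t₁ t₂ => ↑t₁.varFinset ∪ ↑t₂.varFinset
  | rel _ ts => ⋃ i, ↑(ts i).varFinset
  | neg φ => φ.vars
  | conj φ => ⋃ i, (φ i).vars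
  | disj φ => ⋃ i, (φ i).vars
  | ex x φ => {x} ∪ φ.vars
  | all x φ => {x} ∪ φ.vars
  | exCount _ x φ => {x} ∪ φ.vars

/-- The free variables of a formula. -/
def freeVars : InfFormula.{u} L → Set ℕ
  | equal t₁ t₂ => ↑t₁.varFinset ∪ ↑t₂.varFinset
  | rel _ ts => ⋃ i, ↑(ts i).varFinset
  | neg φ => φ.freeVars
  | conj φ => ⋃ i, (φ i).freeVars
  | disj φ => ⋃ i, (φ i).freeVars
  | ex x φ => φ.freeVars \ {x}
  | all x φ => φ.freeVars \ {x}
  | exCount _ x φ => φ.freeVars \ {x}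

/-- Satisfaction of a formula in a structure `M` under an assignment `v`. -/
def Realize {M : Type w} [L.Structure M] : InfFormula.{u} L → (ℕ → M) → Prop
  | equal t₁ t₂, v => t₁.realize v = t₂.realize v
  | rel R ts, v => FirstOrder.Language.Structure.RelMap R fun i => (ts i).realize v
  | neg φ, v => ¬ φ.Realize v
  | conj φ, v => ∀ i, (φ i).Realize v
  | disj φ, v => ∃ i, (φ i).Realize v
  | ex x φ, v => ∃ a : M, φ.Realize (Function.update v x a)
  | all x φ, v => ∀ a : M, φ.Realize (Function.update v x a)
  | exCount m x φ, v => ∃ s : Finset M, s.card = m ∧ ∀ a ∈ s, φ.Realize (Function.update v x a)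

/-- The formulas of `L_{∞ω}(C)`. A conjunction or disjunction is allowed only if the total number
of variables in its members is finite; this holds at every node of a formula if and only if the
formula as a whole has finitely many variables. -/
def IsLInfC (φ : InfFormula.{u} L) : Prop := φ.vars.Finite

end InfFormula

/-! ## The fixed-point extension of first-order logic -/

/-- Formulas of first-order logic extended by inflationary fixed points (nested, and with
parameters). `relVar r i ts` is the atomic formula `Xᵢ(ts)` for the `i`-th `r`-ary relation variable
`Xᵢ`, and `fix r i x φ ts` is `[IFP_{Xᵢ, x} φ](ts)`, with `x` an `r`-tuple of distinct variables. -/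
inductive FPFormula (L : FirstOrder.Language.{0, 0}) : Type
  | equal (t₁ t₂ : L.Term ℕ) : FPFormula L
  | rel {n : ℕ} (R : L.Relations n) (ts : Fin n → L.Term ℕ) : FPFormula L
  | relVar (r i : ℕ) (ts : Fin r → L.Term ℕ) : FPFormula L
  | neg (φ : FPFormula L) : FPFormula L
  | and (φ ψ : FPFormula L) : FPFormula L
  | or (φ ψ : FPFormula L) : FPFormula L
  | ex (x : ℕ) (φ : FPFormula L) : FPFormula L
  | all (x : ℕ) (φ : FPFormula L) : FPFormula L
  | fix (r i : ℕ) (x : Fin r ↪ ℕ) (φ : FPFormula L) (ts : Fin r → L.Term ℕ) : FPFormula L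

namespace FPFormula

variable {L : FirstOrder.Language.{0, 0}}

/-- The free first-order variables of a formula. -/
def freeVars : FPFormula L → Set ℕ
  | equal t₁ t₂ => ↑t₁.varFinset ∪ ↑t₂.varFinset
  | rel _ ts => ⋃ i, ↑(ts i).varFinset
  | relVar _ _ ts => ⋃ i, ↑(ts i).varFinset
  | neg φ => φ.freeVars
  | and φ ψ => φ.freeVars ∪ ψ.freeVars
  | or φ ψ => φ.freeVars ∪ ψ.freeVars
  | ex x φ => φ.freeVars \ {x}
  | all x φ => φ.freeVars \ {x}
  | fix _ _ x φ ts => (φ.freeVars \ Set.range x) ∪ ⋃ i, ↑(ts i).varFinset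

/-- The free relation variables of a formula, as pairs (arity, name). -/
def freeRelVars : FPFormula L → Set (ℕ × ℕ)
  | equal _ _ => ∅
  | rel _ _ => ∅
  | relVar r i _ => {(r, i)}
  | neg φ => φ.freeRelVars
  | and φ ψ => φ.freeRelVars ∪ ψ.freeRelVars
  | or φ ψ => φ.freeRelVars ∪ ψ.freeRelVars
  | ex _ φ => φ.freeRelVars
  | all _ φ => φ.freeRelVars
  | fix r i _ φ _ => φ.freeRelVars \ {(r, i)}

/-- Satisfaction in `M` under a relation assignment `ρ` (`ρ r i` interprets the `i`-th `r`-ary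
relation variable) and an element assignment `v`. The stages of an inflationary fixed point are
`P₀ = ∅` and `Pₙ₊₁ = Pₙ ∪ {a | φ(Pₙ, a)}`; in a finite structure, to which this definition is
meant to be applied, the fixed point is the union of the stages `Pₙ` with `n` finite. -/
def Realize {M : Type w} [L.Structure M] :
    FPFormula L → ((r : ℕ) → ℕ → (Fin r → M) → Prop) → (ℕ → M) → Prop
  | equal t₁ t₂, _, v => t₁.realize v = t₂.realize v
  | rel R ts, _, v => FirstOrder.Language.Structure.RelMap R fun i => (ts i).realize v
  | relVar r i ts, ρ, v => ρ r i fun j => (ts j).realize v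
  | neg φ, ρ, v => ¬ φ.Realize ρ v
  | and φ ψ, ρ, v => φ.Realize ρ v ∧ ψ.Realize ρ v
  | or φ ψ, ρ, v => φ.Realize ρ v ∨ ψ.Realize ρ v
  | ex x φ, ρ, v => ∃ a : M, φ.Realize ρ (Function.update v x a)
  | all x φ, ρ, v => ∀ a : M, φ.Realize ρ (Function.update v x a)
  | fix r i x φ ts, ρ, v =>
      let step : ((Fin r → M) → Prop) → ((Fin r → M) → Prop) := fun P a =>
        P a ∨ φ.Realize (Function.update ρ r (Function.update (ρ r) i P)) (Function.extend x a v)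
      ∃ n : ℕ, step^[n] (fun _ => False) fun j => (ts j).realize v

end FPFormula

/-! ## Classes of finite structures -/

/-- The binary relation `r` is a linear order, either in the strict sense or in the reflexive
sense. -/
def IsLinearOrderRelation {M : Type w} (r : M → M → Prop) : Prop :=
  IsStrictTotalOrder M r ∨ IsLinearOrder M r

/-- The structure has no nontrivial automorphisms. -/
def IsRigid (L : FirstOrder.Language.{0, 0}) (M : Type w) [L.Structure M] : Prop :=
  ∀ θ : M ≃[L] M, ∀ a : M, θ a = a

/-- The class `K` of finite structures is, among finite structures, the class of models of
finitely many first-order sentences. -/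
def FinitelyAxiomatizable {L : FirstOrder.Language.{0, 0}} (K : ∀ (M : Type w) [L.Structure M], Prop) : Prop :=
  ∃ T : L.Theory, T.Finite ∧ ∀ (M : Type w) [L.Structure M] [Finite M], M ⊨ T ↔ K M

/-- The formula `φ`, with two distinct variables `x`, `y` and no other variables free, defines a
linear order in every finite structure of the class `K`. -/
def InfFormula.DefinesLinearOrder {L : FirstOrder.Language.{0, 0}} (φ : InfFormula.{u} L)
    (K : ∀ (M : Type w) [L.Structure M], Prop) : Prop :=
  ∃ x y : ℕ, x ≠ y ∧ φ.freeVars ⊆ {x, y} ∧ ∀ (M : Type w) [L.Structure M] [Finite M], K M →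
    IsLinearOrderRelation fun a b : M => φ.Realize fun n => if n = x then a else b

/-- The fixed-point formula `φ`, with two distinct variables `x`, `y` and no other variables free
(in particular no free relation variables), defines a linear order in every finite structure of the
class `K`. -/
def FPFormula.DefinesLinearOrder {L : FirstOrder.Language.{0, 0}} (φ : FPFormula L)
    (K : ∀ (M : Type w) [L.Structure M], Prop) : Prop :=
  ∃ x y : ℕ, x ≠ y ∧ φ.freeVars ⊆ {x, y} ∧ φ.freeRelVars = ∅ ∧
    ∀ (M : Type w) [L.Structure M] [Finite M], K M →
      IsLinearOrderRelation fun a b : M =>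
        φ.Realize (fun _ _ _ => False) fun n => if n = x then a else b

/-! ## Hypergraphs -/

namespace Multipede

variable {M : Type w}

/-- The pair `(U, T)` is a (3-uniform) hypergraph, `T` being given as a symmetric ternary relation
holding only of triples of pairwise distinct elements. -/
structure IsHypergraph (U : Set M) (T : M → M → M → Prop) : Prop where
  nonempty : U.Nonempty
  mem : ∀ x y z, T x y z → x ∈ U ∧ y ∈ U ∧ z ∈ U
  ne : ∀ x y z, T x y z → x ≠ y ∧ y ≠ z ∧ x ≠ z
  symm : ∀ x y z, T x y z → T y x z ∧ T x z y

/-- The hyperedges, as 3-element sets. -/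
def hyperedges (T : M → M → M → Prop) : Set (Set M) :=
  {h | ∃ x y z, T x y z ∧ h = {x, y, z}}

/-- The sub-hypergraph of `T` on the vertex set `V` is odd: every nonempty vertex set meets some
hyperedge in an odd number of vertices. -/
def IsOdd (V : Set M) (T : M → M → M → Prop) : Prop :=
  ∀ X ⊆ V, X.Nonempty → ∃ h ∈ hyperedges T, h ⊆ V ∧ Odd (h ∩ X).ncard

/-! ## Multipedes -/

/-- The feet: the domain of `E`. -/
def feet (E : M → M → Prop) : Set M := {x | ∃ y, E x y}

/-- The segments: the range of `E`. -/
def segments (E : M → M → Prop) : Set M := {y | ∃ x, E x y}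

/-- The set `S(A)` of the segments of the feet in `A`. -/
def segmentsOf (E : M → M → Prop) (A : Set M) : Set M := {y | ∃ x ∈ A, E x y}

structure IsOneMultipede (U : Set M) (E : M → M → Prop) : Prop where
  disjoint : feet E ∩ segments E = ∅
  cover : feet E ∪ segments E = U
  foot : ∀ x ∈ feet E, ∃! y, E x y
  segment : ∀ y ∈ segments E, {x | E x y}.ncard = 2

structure IsTwoMinusMultipede (U : Set M) (E : M → M → Prop) (T : M → M → M → Prop) : Prop where
  oneMultipede : IsOneMultipede U E
  hypergraph : IsHypergraph U T
  uniform : ∀ h ∈ hyperedges T, h ⊆ segments E ∨ h ⊆ feet E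
  project : ∀ h ∈ hyperedges T, h ⊆ feet E → segmentsOf E h ∈ hyperedges T

/-- `A` is a slave of the segment hyperedge `X`. -/
def IsSlave (E : M → M → Prop) (X A : Set M) : Prop :=
  A ⊆ feet E ∧ A.ncard = 3 ∧ segmentsOf E A = X

/-- The positive slaves of `X` are those that are hyperedges. -/
def positiveSlaves (E : M → M → Prop) (T : M → M → M → Prop) (X : Set M) : Set (Set M) :=
  {A | IsSlave E X A ∧ A ∈ hyperedges T}

open Classical in
/-- Two slaves `A`, `B` of `X` are equivalent if they are identical or one is obtained from the
other by permuting the feet `a, a'` of a segment `s` and the feet `b, b'` of a segment `t`, where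
`s ≠ t` are in `X`. -/
def SlaveEquiv (E : M → M → Prop) (X A B : Set M) : Prop :=
  A = B ∨ ∃ s ∈ X, ∃ t ∈ X, s ≠ t ∧ ∃ a a' b b', a ≠ a' ∧ E a s ∧ E a' s ∧ b ≠ b' ∧ E b t ∧ E b' t ∧
    B = (fun c => Equiv.swap a a' (Equiv.swap b b' c)) '' A

structure IsTwoMultipede (U : Set M) (E : M → M → Prop) (T : M → M → M → Prop) : Prop where
  twoMinusMultipede : IsTwoMinusMultipede U E T
  four : ∀ X ∈ hyperedges T, X ⊆ segments E → (positiveSlaves E T X).ncard = 4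
  equiv : ∀ X ∈ hyperedges T, X ⊆ segments E →
    ∀ A ∈ positiveSlaves E T X, ∀ B ∈ positiveSlaves E T X, SlaveEquiv E X A B

/-- `lt` is a (strict) linear order on the set of segments. -/
structure IsThreeMultipede (U : Set M) (E : M → M → Prop) (T : M → M → M → Prop)
    (lt : M → M → Prop) : Prop where
  twoMultipede : IsTwoMultipede U E T
  lt_mem : ∀ x y, lt x y → x ∈ segments E ∧ y ∈ segments E
  lt_irrefl : ∀ x, ¬ lt x x
  lt_trans : ∀ x y z, lt x y → lt y z → lt x z
  lt_total : ∀ x ∈ segments E, ∀ y ∈ segments E, x = y ∨ lt x y ∨ lt y x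

/-- On the elements of `M` that are feet or segments there is a 3-multipede; the remaining elements,
the super-segments, represent uniquely all sets of segments by the containment relation `eps`. -/
structure IsFourMultipede (E : M → M → Prop) (T : M → M → M → Prop)
    (lt eps : M → M → Prop) : Prop where
  threeMultipede : IsThreeMultipede (feet E ∪ segments E) E T lt
  eps_mem : ∀ x Y, eps x Y → x ∈ segments E ∧ Y ∉ feet E ∪ segments E
  represent : ∀ X ⊆ segments E, ∃! Y, Y ∉ feet E ∪ segments E ∧ ∀ x, eps x Y ↔ x ∈ X

/-- The relation symbols of the vocabulary of 4-multipedes. -/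
inductive Symbol : ℕ → Type
  | edge : Symbol 2
  | hyper : Symbol 3
  | less : Symbol 2
  | contain : Symbol 2

/-- The (finite, purely relational) vocabulary of 4-multipedes. -/
def vocabulary : FirstOrder.Language.{0, 0} := ⟨fun _ => Empty, Symbol⟩

/-- The structure `M` is an odd 4-multipede. -/
def IsOddFourMultipede (M : Type w) [vocabulary.Structure M] : Prop :=
  let E : M → M → Prop := fun x y => FirstOrder.Language.Structure.RelMap (L := vocabulary) Symbol.edge ![x, y]
  let T : M → M → M → Prop := fun x y z =>
    FirstOrder.Language.Structure.RelMap (L := vocabulary) Symbol.hyper ![x, y, z]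
  let lt : M → M → Prop := fun x y => FirstOrder.Language.Structure.RelMap (L := vocabulary) Symbol.less ![x, y]
  let eps : M → M → Prop := fun x Y => FirstOrder.Language.Structure.RelMap (L := vocabulary) Symbol.contain ![x, Y]
  IsFourMultipede E T lt eps ∧ IsOdd (segments E) T

end Multipede

/-! A multipede is a system of linear equations over `ZMod 2` in disguise. A permutation of the feet
that fixes all segments is a twist: a function `t` telling at which segments the two feet are
exchanged. It respects the positive slaves exactly when `t` sums to zero over every segment
hyperedge. Oddness says that this system has only the zero solution, and this gives rigidity
(`IsFourMultipede.perm_eq`): an automorphism fixes the segments because they are linearly ordered,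
then the feet by oddness, then the super-segments because of the sets they represent. Oddness
quantifies over sets of segments; super-segments turn these sets into elements, which makes the
class first-order axiomatizable.

A formula with few variables sees only a few equations at a time. So a system is needed that has no
nonzero solution although its small parts impose no constraint on single unknowns. Take as segments
the elements of a finite group with three involutions `a 0`, `a 1`, `a 2`, and as hyperedges the
sets `{a 0 * g, a 1 * g, a 2 * g}`. If the group is a 2-group, the hypergraph is odd
(`eq_zero_of_sum_eq_zero`). If no short reduced word in the involutions is trivial, the hypergraph
is locally a tree, and a small set of hyperedges has a mod 2 sum at least as large as itself
(`card_supp_le_boundary`). Groups with both properties exist (`exists_twoGroup`).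

By this expansion, a twist of a few segments that obeys all consequences of at most `K` equations
extends to any further segment (`Consistent.extend`). That is a winning strategy in the bijective
pebble game (`Matches.exists_equiv`), so assignments that differ by a consistent twist satisfy the
same formulas (`realize_infFormula_iff`, `realize_fpFormula_iff`; fixed points are handled directly,
not by translation into infinitary logic). Exchanging the feet of one segment is consistent
(`consistent_singleton`). Hence a formula holds of these two feet in one order if and only if it
holds in the other, which no linear order allows. -/

/-! ## Finite 2-groups with three involutions and no short relations -/

namespace Multipede

/-- The product `a (w (n-1)) * ⋯ * a (w 1) * a (w 0)`. -/
def wordProd {G : Type*} [Group G] (a : Fin 3 → G) (w : ℕ → Fin 3) : ℕ → G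
  | 0 => 1
  | n + 1 => a (w n) * wordProd a w n

/-- The permutations of `(ZMod 2)^N` that change each coordinate by a function of the preceding
coordinates. -/
def triangular (N : ℕ) : Subgroup (Equiv.Perm (Fin N → ZMod 2)) where
  carrier := {u | ∀ j x y, (∀ l < j, x l = y l) → u x j - x j = u y j - y j}
  one_mem' := by intro j x y _; simp
  mul_mem' := by
    intro u v hu hv j x y h
    have h1 := hu j (v x) (v y) fun l hl => by
      have := hv l x y fun m hm => h m (hm.trans hl)
      rw [h l hl] at this
      simpa using this
    have h2 := hv j x y h
    rw [Equiv.Perm.mul_apply, Equiv.Perm.mul_apply]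
    linear_combination h1 + h2
  inv_mem' := by
    intro u hu j x y h
    have hinv : ∀ z, u (u⁻¹ z) = z := u.apply_symm_apply
    have key : ∀ l ≤ j, (∀ m < l, u⁻¹ x m = u⁻¹ y m) := by
      intro l
      induction l using WellFoundedLT.induction with
      | ind l ih =>
        intro hl m hm
        have := hu m (u⁻¹ x) (u⁻¹ y) (ih m hm (hm.le.trans hl))
        rw [hinv, hinv, h m (hm.trans_le hl)] at this
        simpa using this
    have := hu j (u⁻¹ x) (u⁻¹ y) (key j le_rfl)
    rw [hinv, hinv] at this
    linear_combination -this

/-- Once the coordinates before `k` are fixed by `u ^ 2 ^ k`, this power adds to coordinate `k` the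
same amount at `x` and at its image; squaring adds it twice, that is, zero. -/
theorem triangular_pow {N : ℕ} {u : Equiv.Perm (Fin N → ZMod 2)} (hu : u ∈ triangular N) (k : ℕ) :
    ∀ x (l : Fin N), (l : ℕ) < k → (u ^ 2 ^ k) x l = x l := by
  induction k with
  | zero => intro x l hl; omega
  | succ k ih =>
    intro x l hl
    have hs : u ^ 2 ^ (k + 1) = u ^ 2 ^ k * u ^ 2 ^ k := by rw [← pow_add]; congr 1; ring
    rw [hs, Equiv.Perm.mul_apply]
    rcases Nat.lt_succ_iff_lt_or_eq.1 hl with h | h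
    · rw [ih _ l h, ih _ l h]
    · have hm := Subgroup.pow_mem _ hu (2 ^ k)
      have := hm l ((u ^ 2 ^ k) x) x fun m hm => ih x m (by rw [← h]; exact hm)
      have h2 : (2 : ZMod 2) = 0 := rfl
      linear_combination this + ((u ^ 2 ^ k) x l - x l) * h2

theorem triangular_pow_eq_one {N : ℕ} {u : Equiv.Perm (Fin N → ZMod 2)} (hu : u ∈ triangular N) :
    u ^ 2 ^ N = 1 := by
  ext1 x
  funext l
  exact triangular_pow hu N x l l.2

/-- The letter `i` of the word `u` acts at position `j` if it occurs there and does not occur at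
the preceding position. -/
def ActsAt (u : ℕ → Fin 3) (i : Fin 3) (j : ℕ) : Prop :=
  u j = i ∧ ∀ m, m + 1 = j → u m ≠ i

open Classical in
/-- The action of the letter `i` on `(ZMod 2)^(L+1)`. -/
noncomputable def letterFun (L : ℕ) (u : ℕ → Fin 3) (i : Fin 3) (x : Fin (L + 1) → ZMod 2) :
    Fin (L + 1) → ZMod 2 :=
  Fin.cases (x 0) fun j => x j.succ + if ActsAt u i j then x j.castSucc else 0

theorem letterFun_zero (L : ℕ) (u : ℕ → Fin 3) (i : Fin 3) (x : Fin (L + 1) → ZMod 2) :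
    letterFun L u i x 0 = x 0 := rfl

open Classical in
theorem letterFun_succ (L : ℕ) (u : ℕ → Fin 3) (i : Fin 3) (x : Fin (L + 1) → ZMod 2) (j : Fin L) :
    letterFun L u i x j.succ = x j.succ + if ActsAt u i j then x j.castSucc else 0 := rfl

/-- A letter never acts at two adjacent positions, so it does not alter a coordinate from which it
reads. This makes the letters involutions even for words that are not reduced. -/
theorem letterFun_castSucc {L : ℕ} {u : ℕ → Fin 3} {i : Fin 3} (x : Fin (L + 1) → ZMod 2)
    {j : Fin L} (h : ActsAt u i j) : letterFun L u i x j.castSucc = x j.castSucc := by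
  obtain ⟨j, hj⟩ := j
  cases j with
  | zero => rfl
  | succ m =>
    have : (Fin.castSucc ⟨m + 1, hj⟩ : Fin (L + 1)) = Fin.succ ⟨m, by omega⟩ := rfl
    rw [this, letterFun_succ, if_neg, add_zero]
    exact fun h' => h.2 m rfl h'.1

theorem letterFun_involutive (L : ℕ) (u : ℕ → Fin 3) (i : Fin 3) :
    Function.Involutive (letterFun L u i) := by
  intro x
  funext j
  refine Fin.cases rfl (fun j => ?_) j
  rw [letterFun_succ, letterFun_succ]
  split_ifs with h
  · rw [letterFun_castSucc x h, add_assoc, CharTwo.add_self_eq_zero, add_zero]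
  · simp

/-- The action of the letter `i`, as a triangular permutation. -/
noncomputable def letterPerm (L : ℕ) (u : ℕ → Fin 3) (i : Fin 3) : triangular (L + 1) :=
  ⟨(letterFun_involutive L u i).toPerm, by
    intro j x y h
    refine Fin.cases (fun _ => ?_) (fun j h => ?_) j h
    · simp [letterFun_zero]
    · simp only [Function.Involutive.coe_toPerm, letterFun_succ, add_sub_cancel_left]
      rw [h _ (Fin.castSucc_lt_succ)]⟩

theorem letterPerm_mul_self (L : ℕ) (u : ℕ → Fin 3) (i : Fin 3) :
    letterPerm L u i * letterPerm L u i = 1 := by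
  ext1
  ext1 x
  exact letterFun_involutive L u i x

/-- The last nonzero coordinate moves one place with each letter: since `w` is reduced, `w n` acts
at position `n` and copies the 1 there into coordinate `n + 1`. Coordinates before the last one are
left uncontrolled. -/
theorem wordProd_letterPerm (L : ℕ) (v w : ℕ → Fin 3) (hw : ∀ l, w l ≠ w (l + 1))
    (hv : ∀ l < L, v l = w l) (n : ℕ) :
    ∀ j : Fin (L + 1), ((wordProd (letterPerm L v) w n : triangular (L + 1)) :
      Equiv.Perm (Fin (L + 1) → ZMod 2)) (Pi.single 0 1) j = 1 ∧ (j : ℕ) = n ∨ (j : ℕ) < n ∨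
      ((wordProd (letterPerm L v) w n : triangular (L + 1)) :
      Equiv.Perm (Fin (L + 1) → ZMod 2)) (Pi.single 0 1) j = 0 ∧ n < (j : ℕ) := by
  induction n with
  | zero =>
    intro j
    refine Fin.cases ?_ (fun j => ?_) j
    · simp [wordProd]
    · simp [wordProd]
  | succ n ih =>
    intro j
    refine Fin.cases (by simp) (fun j => ?_) j
    have e : ((wordProd (letterPerm L v) w (n + 1) : triangular (L + 1)) :
      Equiv.Perm (Fin (L + 1) → ZMod 2)) (Pi.single 0 1) = letterFun L v (w n)
        (((wordProd (letterPerm L v) w n : triangular (L + 1)) :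
          Equiv.Perm (Fin (L + 1) → ZMod 2)) (Pi.single 0 1)) := rfl
    rw [e, letterFun_succ]
    have h1 := ih j.succ
    have h2 := ih j.castSucc
    simp only [Fin.val_succ, Fin.val_castSucc] at h1 h2 ⊢
    rcases lt_trichotomy (j : ℕ) n with h | h | h
    · omega
    · left
      have a1 : ActsAt v (w n) j := ⟨by rw [hv _ j.2, h], fun m hm => by
        have := hw m
        have hj := j.2
        rw [hm, h] at this
        rwa [hv _ (by omega)]⟩
      rw [if_pos a1]
      rcases h1 with h1 | h1 | h1
      · omega
      · omega
      rcases h2 with h2 | h2 | h2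
      · rw [h1.1, h2.1]; simp [h]
      · omega
      · omega
    · right; right
      rcases h1 with h1 | h1 | h1
      · omega
      · omega
      rcases h2 with h2 | h2 | h2
      · omega
      · omega
      · rw [h1.1, h2.1]; simp [h]

theorem wordProd_pi {ι : Type*} {H : ι → Type*} [∀ i, Group (H i)] (a : Fin 3 → ∀ i, H i)
    (w : ℕ → Fin 3) (n : ℕ) (i : ι) : wordProd a w n i = wordProd (fun l => a l i) w n := by
  induction n with
  | zero => rfl
  | succ n ih => simp [wordProd, ih]

/-- There are finite 2-groups with three involutions such that reduced words of bounded length in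
the involutions are nontrivial. -/
theorem exists_twoGroup (L : ℕ) : ∃ (G : Type) (_ : Group G) (_ : Finite G) (a : Fin 3 → G),
    IsPGroup 2 G ∧ (∀ i, a i * a i = 1) ∧
    ∀ w : ℕ → Fin 3, (∀ l, w l ≠ w (l + 1)) → ∀ n, 0 < n → n ≤ L → wordProd a w n ≠ 1 := by
  have hext : ∀ u : Fin L → Fin 3, ∃ w : ℕ → Fin 3, ∀ l : Fin L, w l = u l :=
    fun u => ⟨fun l => if h : l < L then u ⟨l, h⟩ else 0, fun l => by simp⟩
  choose ext hext using hext
  -- One factor for each word of length `L`; a reduced word is detected in the factor that belongs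
  -- to its own first `L` letters.
  refine ⟨(Fin L → Fin 3) → triangular (L + 1), inferInstance, inferInstance,
    fun i u => letterPerm L (ext u) i, ?_, ?_, ?_⟩
  · intro g
    refine ⟨L + 1, ?_⟩
    funext u
    exact Subtype.ext (triangular_pow_eq_one (g u).2)
  · intro i
    funext u
    exact letterPerm_mul_self L _ i
  · intro w hw n hn hL h1
    have h := wordProd_letterPerm L (ext fun l => w l) w hw (fun l hl => hext _ ⟨l, hl⟩) n
      ⟨n, by omega⟩
    have h2 := congrFun h1 fun l => w l
    rw [wordProd_pi] at h2
    rw [h2] at h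
    simp [Fin.ext_iff, hn.ne'] at h

end Multipede

/-! ## Expansion of the hypergraph of a group with three involutions -/

namespace Multipede

section Expansion

variable {G : Type*} [Group G]

/-- No nonempty reduced word of length at most `L` in the letters `a` is trivial. -/
def NoShortRelation (a : Fin 3 → G) (L : ℕ) : Prop :=
  ∀ w : ℕ → Fin 3, (∀ l, w l ≠ w (l + 1)) → ∀ n, 0 < n → n ≤ L → wordProd a w n ≠ 1

theorem wordProd_add (a : Fin 3 → G) (w : ℕ → Fin 3) (m n : ℕ) :
    wordProd a w (m + n) = wordProd a (fun l => w (m + l)) n * wordProd a w m := by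
  induction n with
  | zero => simp [wordProd]
  | succ n ih => rw [← add_assoc, wordProd, ih, wordProd, mul_assoc]

theorem NoShortRelation.injective {a : Fin 3 → G} {L : ℕ} (ha : ∀ i, a i * a i = 1)
    (h : NoShortRelation a L) (hL : 2 ≤ L) : Function.Injective a := by
  intro i j hij
  by_contra hne
  refine h (fun l => if l % 2 = 0 then i else j) (fun l => ?_) 2 two_pos hL ?_
  · rcases Nat.mod_two_eq_zero_or_one l with h | h <;> simp [Nat.add_mod, h, hne, Ne.symm hne]
  · simp [wordProd, hij, ha]

/-- The vertices of the hyperedge `g` are `a 0 * g`, `a 1 * g`, `a 2 * g`. In a finite nonempty set of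
hyperedges there is one that shares at most one of its vertices with the others. -/
theorem exists_leaf {a : Fin 3 → G} {F : Finset G} (h : NoShortRelation a (2 * F.card))
    (hF : F.Nonempty) :
    ∃ g ∈ F, ∃ x : Fin 3, ∀ y, y ≠ x → ∀ z, z ≠ y → a z * (a y * g) ∉ F := by
  by_contra! hcon
  choose! Y hY Z hZ hmem using hcon
  obtain ⟨g₀, hg₀⟩ := hF
  -- A walk through the hyperedges in `F`; the second component is the letter of the vertex through
  -- which the current hyperedge was entered. Without a leaf it can be left through a different
  -- letter `Y` into a hyperedge where the same vertex has a letter `Z ≠ Y`. The letters read off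
  -- form a reduced word, and a repetition within `F.card` steps is a relation of length at most `2
  -- * F.card`.
  let step : G × Fin 3 → G × Fin 3 := fun p => (a (Z p.1 p.2) * (a (Y p.1 p.2) * p.1), Z p.1 p.2)
  let st : ℕ → G × Fin 3 := fun n => step^[n] (g₀, 0)
  have hst : ∀ n, st (n + 1) = step (st n) := fun n => Function.iterate_succ_apply' step n _
  have hstF : ∀ n, (st n).1 ∈ F := by
    intro n
    induction n with
    | zero => exact hg₀
    | succ n ih => rw [hst]; exact hmem _ ih _
  let w : ℕ → Fin 3 := fun l => if l % 2 = 0 then Y (st (l / 2)).1 (st (l / 2)).2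
    else Z (st (l / 2)).1 (st (l / 2)).2
  have w0 : ∀ n, w (2 * n) = Y (st n).1 (st n).2 := fun n => by simp [w]
  have w1 : ∀ n, w (2 * n + 1) = Z (st n).1 (st n).2 := fun n => by
    simp [w, Nat.add_mod, show (2 * n + 1) / 2 = n by omega]
  have hw : ∀ l, w l ≠ w (l + 1) := by
    intro l
    rcases Nat.even_or_odd' l with ⟨n, rfl | rfl⟩
    · rw [w0, w1]; exact (hZ _ (hstF n) _).symm
    · rw [w1, show 2 * n + 1 + 1 = 2 * (n + 1) by ring, w0]
      have := hY _ (hstF (n + 1)) (st (n + 1)).2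
      intro h'
      rw [← h', hst] at this
      exact this rfl
  have hprod : ∀ n, (st n).1 = wordProd a w (2 * n) * g₀ := by
    intro n
    induction n with
    | zero => simp [wordProd, st]
    | succ n ih =>
      rw [hst, show 2 * (n + 1) = 2 * n + 1 + 1 by ring, wordProd, wordProd, w0, w1, mul_assoc,
        mul_assoc, ← ih]
  obtain ⟨i, hi, j, hj, hij, heq⟩ := Finset.exists_ne_map_eq_of_card_lt_of_maps_to
    (s := Finset.range (F.card + 1)) (t := F) (by simp) (f := fun n => (st n).1)
    (fun n _ => hstF n)
  wlog hlt : i < j generalizing i j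
  · exact this j hj i hi hij.symm heq.symm (by omega)
  simp only [Finset.mem_range] at hi hj
  obtain ⟨d, rfl⟩ := Nat.exists_eq_add_of_lt hlt
  rw [show i + d + 1 = i + (d + 1) by ring] at heq hj
  simp only [hprod, mul_left_inj] at heq
  rw [mul_add, wordProd_add, eq_comm, mul_eq_right] at heq
  exact h _ (fun l => hw (2 * i + l)) _ (by omega) (by omega) heq

/-- The number modulo 2 of hyperedges in `f` that contain the vertex `s`; the letters `a` are
supposed to be involutions. -/
def boundary (a : Fin 3 → G) (f : G → ZMod 2) (s : G) : ZMod 2 := ∑ i, f (a i * s)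

theorem boundary_add (a : Fin 3 → G) (f f' : G → ZMod 2) :
    boundary a (f + f') = boundary a f + boundary a f' := by
  funext s
  simp [boundary, Finset.sum_add_distrib]

theorem mul_eq_iff_of_involution {a : Fin 3 → G} (ha : ∀ i, a i * a i = 1) (i : Fin 3) (g s : G) :
    a i * s = g ↔ s = a i * g := by
  constructor
  · rintro rfl; rw [← mul_assoc, ha, one_mul]
  · rintro rfl; rw [← mul_assoc, ha, one_mul]

/-- The support of a function. -/
def supp {V : Type*} [Fintype V] (f : V → ZMod 2) : Finset V := Finset.univ.filter fun s => f s ≠ 0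

theorem mem_supp {V : Type*} [Fintype V] {f : V → ZMod 2} {s : V} : s ∈ supp f ↔ f s ≠ 0 := by
  simp [supp]

theorem zmod_two_eq_one {x : ZMod 2} (h : x ≠ 0) : x = 1 := by
  revert x; decide

variable [Fintype G]

/-- A small set of hyperedges has at least as many boundary vertices as hyperedges. -/
theorem card_supp_le_boundary [DecidableEq G] {a : Fin 3 → G} (ha : ∀ i, a i * a i = 1)
    (hinj : Function.Injective a) {m : ℕ} (h : NoShortRelation a (2 * m)) :
    ∀ n, ∀ f : G → ZMod 2, (supp f).card = n → n ≤ m → n ≤ (supp (boundary a f)).card := by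
  intro n
  induction n with
  | zero => intro f _ _; exact Nat.zero_le _
  | succ n ih =>
    intro f hf hn
    obtain ⟨g, hg, x, hx⟩ := exists_leaf (F := supp f) (a := a)
      (fun w hw l hl hl' => h w hw l hl (by omega)) (by rw [← Finset.card_pos]; omega)
    have hfg := zmod_two_eq_one (mem_supp.1 hg)
    let f' : G → ZMod 2 := Function.update f g 0
    have hs' : supp f' = (supp f).erase g := by
      ext s
      by_cases hs : s = g
      · subst hs; simp [supp, f']
      · simp [supp, f', hs]
    have hih := ih f' (by rw [hs', Finset.card_erase_of_mem hg, hf]; rfl) (by omega)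
    have hb1 : ∀ y, y ≠ x → boundary a f (a y * g) = 1 := by
      intro y hy
      rw [boundary, Finset.sum_eq_single y, ← mul_assoc, ha, one_mul, hfg]
      · intro z _ hz
        have := hx y hy z hz
        simpa [mem_supp] using this
      · simp
    have hb0 : ∀ y, y ≠ x → boundary a f' (a y * g) = 0 := by
      intro y hy
      refine Finset.sum_eq_zero fun z _ => ?_
      by_cases hz : z = y
      · rw [hz, ← mul_assoc, ha, one_mul]; simp [f']
      · have := hx y hy z hz
        rw [mem_supp, not_not] at this
        by_cases hzg : a z * (a y * g) = g
        · simp [f', hzg]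
        · simp [f', hzg, this]
    have hb : ∀ s, (∀ i, s ≠ a i * g) → boundary a f' s = boundary a f s := by
      intro s hs
      refine Finset.sum_congr rfl fun i _ => ?_
      have : a i * s ≠ g := fun h' => hs i ((mul_eq_iff_of_involution ha i g s).1 h')
      simp [f', this]
    obtain ⟨y₁, y₂, h1, h2, h12, hall⟩ : ∃ y₁ y₂ : Fin 3, y₁ ≠ x ∧ y₂ ≠ x ∧ y₁ ≠ y₂ ∧
        ∀ i, i = x ∨ i = y₁ ∨ i = y₂ := by
      clear hx hb1 hb0; clear_value f'; revert x; decide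
    -- Adding the leaf `g` back to `f'` gains its two private vertices and can cancel only the
    -- vertex `a x * g`, a net gain of at least one.
    have hsub : insert (a y₁ * g) (insert (a y₂ * g) ((supp (boundary a f')).erase (a x * g))) ⊆
        supp (boundary a f) := by
      intro s hs
      simp only [Finset.mem_insert, Finset.mem_erase] at hs
      rw [mem_supp]
      rcases hs with rfl | rfl | ⟨hs, hs'⟩
      · rw [hb1 _ h1]; decide
      · rw [hb1 _ h2]; decide
      · rw [mem_supp] at hs'
        rw [← hb]
        · exact hs'
        · intro i hi
          rcases hall i with rfl | rfl | rfl
          · exact hs hi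
          · rw [hi, hb0 _ h1] at hs'; exact hs' rfl
          · rw [hi, hb0 _ h2] at hs'; exact hs' rfl
    have hcard := Finset.card_le_card hsub
    rw [Finset.card_insert_of_notMem, Finset.card_insert_of_notMem] at hcard
    · have := Finset.pred_card_le_card_erase (s := supp (boundary a f')) (a := a x * g)
      omega
    · simp [mem_supp, hb0 _ h2]
    · simp [mem_supp, hb0 _ h1, hinj.eq_iff, h12]

/-- The only function with even sum on every hyperedge is zero, if the group is a 2-group. -/
theorem eq_zero_of_sum_eq_zero {a : Fin 3 → G} (hG : IsPGroup 2 G) {f : G → ZMod 2}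
    (hf : ∀ g, f (a 0 * g) + f (a 1 * g) + f (a 2 * g) = 0) : f = 0 := by
  by_contra hne
  let V : AddSubgroup (G → ZMod 2) :=
    { carrier := {f | ∀ g, f (a 0 * g) + f (a 1 * g) + f (a 2 * g) = 0}
      zero_mem' := by intro g; simp
      add_mem' := by
        intro f f' h h' g
        simp only [Pi.add_apply]
        linear_combination h g + h' g
      neg_mem' := by
        intro f h g
        simp only [Pi.neg_apply]
        linear_combination -h g }
  -- Right translations commute with the left multiplications in the equations, so they permute the
  -- solutions. A 2-group acting on a set of even size with the fixed point 0 has another fixed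
  -- point; it is a constant function, and three equal summands add up to zero only if they vanish.
  let act : MulAction G V :=
    { smul := fun h f => ⟨fun g => f.1 (g * h), fun g => by
        simpa [mul_assoc] using f.2 (g * h)⟩
      one_smul := fun f => Subtype.ext (funext fun g => congrArg f.1 (mul_one g))
      mul_smul := fun h h' f => Subtype.ext (funext fun g => congrArg f.1 (mul_assoc g h h').symm) }
  have hdvd : 2 ∣ Nat.card V := by
    have h2 : addOrderOf (⟨f, hf⟩ : V) = 2 := by
      refine addOrderOf_eq_prime ?_ ?_
      · refine Subtype.ext ?_
        change 2 • f = 0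
        funext g
        simp [CharTwo.two_eq_zero]
      · intro h0
        exact hne (congrArg Subtype.val h0)
    have := addOrderOf_dvd_natCard (⟨f, hf⟩ : V)
    rwa [h2] at this
  obtain ⟨b, hb, hb0⟩ := hG.exists_fixed_point_of_prime_dvd_card_of_fixed_point V hdvd
    (a := 0) (fun h => rfl)
  have hconst : ∀ g, b.1 g = b.1 1 := by
    intro g
    have := congrFun (congrArg Subtype.val (hb g)) 1
    change b.1 (1 * g) = b.1 1 at this
    rwa [one_mul] at this
  have h3 := b.2 1
  rw [hconst (a 0 * 1), hconst (a 1 * 1), hconst (a 2 * 1), CharTwo.add_self_eq_zero, zero_add] at h3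
  refine hb0 (Subtype.ext (funext fun g => ?_))
  rw [hconst g, h3]
  rfl

end Expansion

/-! ## Locally consistent twists -/

section Consistency

variable {V : Type*} [Fintype V]

/-- `d` maps the sets of at most `2 * K` hyperedges to sets of vertices that are not smaller. -/
structure Expands (d : (V → ZMod 2) → V → ZMod 2) (K : ℕ) : Prop where
  map_add : ∀ f f', d (f + f') = d f + d f'
  card_le : ∀ f, (supp f).card ≤ 2 * K → (supp f).card ≤ (supp (d f)).card

/-- The twist `t` of the segments in `P` is consistent with every set of at most `K` hyperedges. -/
def Consistent (d : (V → ZMod 2) → V → ZMod 2) (K : ℕ) (t : V → ZMod 2) (P : Finset V) : Prop :=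
  ∀ f, (supp f).card ≤ K → supp (d f) ⊆ P → ∑ s, d f s * t s = 0

variable {d : (V → ZMod 2) → V → ZMod 2} {K : ℕ} {t t' : V → ZMod 2} {P Q : Finset V}

theorem Consistent.mono (h : Consistent d K t Q) (hPQ : P ⊆ Q) : Consistent d K t P :=
  fun f hf hP => h f hf (hP.trans hPQ)

theorem Consistent.congr (h : Consistent d K t P) (ht : ∀ s ∈ P, t' s = t s) :
    Consistent d K t' P := by
  intro f hf hP
  rw [← h f hf hP]
  refine Finset.sum_congr rfl fun s _ => ?_
  by_cases hs : d f s = 0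
  · simp [hs]
  · rw [ht s (hP (mem_supp.2 hs))]

theorem card_supp_add_le (f f' : V → ZMod 2) :
    (supp (f + f')).card ≤ (supp f).card + (supp f').card := by
  classical
  refine (Finset.card_le_card fun s hs => ?_).trans (Finset.card_union_le _ _)
  rw [Finset.mem_union, mem_supp, mem_supp]
  rw [mem_supp] at hs
  by_contra! h
  exact hs (by simp [h.1, h.2])

variable [DecidableEq V] in
/-- A consistent twist can be extended to a further segment. -/
theorem Consistent.extend (hd : Expands d K) (h : Consistent d K t P) (hP : P.card ≤ K) (s : V) :
    ∃ b, (s ∈ P → b = t s) ∧ Consistent d K (Function.update t s b) (insert s P) := by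
  by_cases hs : s ∈ P
  · exact ⟨t s, fun _ => rfl, by simpa [hs] using h⟩
  have hsum : ∀ f b, ∑ r, d f r * Function.update t s b r =
      d f s * b + ∑ r ∈ Finset.univ.erase s, d f r * t r := by
    intro f b
    rw [← Finset.add_sum_erase _ _ (Finset.mem_univ s)]
    simp only [Function.update_self]
    congr 1
    refine Finset.sum_congr rfl fun r hr => ?_
    rw [Function.update_of_ne (Finset.ne_of_mem_erase hr)]
  -- The bound `2 * K` leaves room for a sum of two admissible sets: its boundary lies in `P`, so
  -- expansion brings its size down to `P.card ≤ K`, where consistency applies.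
  have hzero : ∀ f, supp (d f) ⊆ insert s P → d f s = 0 → (supp f).card ≤ 2 * K →
      ∑ r ∈ Finset.univ.erase s, d f r * t r = 0 := by
    intro f hsub h0 hc
    have hsub' : supp (d f) ⊆ P := fun r hr => by
      rcases Finset.mem_insert.1 (hsub hr) with rfl | hr'
      · exact absurd h0 (mem_supp.1 hr)
      · exact hr'
    have := h f ((hd.card_le f hc).trans ((Finset.card_le_card hsub').trans hP)) hsub'
    rwa [← Finset.add_sum_erase _ _ (Finset.mem_univ s), h0, zero_mul, zero_add] at this
  -- Such an `f₀` forces the value at `s`. Any other `f` through `s` forces the same value, because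
  -- `s` cancels in the boundary of `f + f₀`.
  by_cases hex : ∃ f₀, (supp f₀).card ≤ K ∧ supp (d f₀) ⊆ insert s P ∧ d f₀ s ≠ 0
  · obtain ⟨f₀, hc, hsub, h1⟩ := hex
    refine ⟨∑ r ∈ Finset.univ.erase s, d f₀ r * t r, fun h => absurd h hs, fun f hf hfs => ?_⟩
    rw [hsum]
    by_cases h0 : d f s = 0
    · rw [h0, zero_mul, zero_add]
      exact hzero f hfs h0 (by omega)
    · have hz := hzero (f + f₀) ?_ ?_ ?_
      · rw [zmod_two_eq_one h0, one_mul, ← hz, hd.map_add, ← Finset.sum_add_distrib]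
        refine Finset.sum_congr rfl fun r _ => ?_
        simp only [Pi.add_apply]
        ring
      · rw [hd.map_add]
        intro r hr
        rw [mem_supp] at hr
        by_contra hr'
        refine hr ?_
        have e1 : d f r = 0 := by by_contra h; exact hr' (hfs (mem_supp.2 h))
        have e2 : d f₀ r = 0 := by by_contra h; exact hr' (hsub (mem_supp.2 h))
        simp [e1, e2]
      · rw [hd.map_add, Pi.add_apply, zmod_two_eq_one h0, zmod_two_eq_one h1]; decide
      · have := card_supp_add_le f f₀
        omega
  · push Not at hex
    refine ⟨0, fun h => absurd h hs, fun f hf hfs => ?_⟩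
    have h0 := hex f hf hfs
    rw [hsum, h0, zero_mul, zero_add]
    exact hzero f hfs h0 (by omega)

end Consistency

end Multipede

/-! ## Rigidity -/

namespace Multipede

/-! ### Symmetric triples as three-element sets. -/

section Hyperedges

variable {M : Type*}

theorem IsHypergraph.rel_of_set_eq {U : Set M} {T : M → M → M → Prop} (hT : IsHypergraph U T)
    {x y z x' y' z' : M} (h : T x y z) (he : ({x', y', z'} : Set M) = {x, y, z}) : T x' y' z' := by
  obtain ⟨hxy, hyz, hxz⟩ := hT.ne x y z h
  have hx : x' = x ∨ x' = y ∨ x' = z := by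
    have : x' ∈ ({x, y, z} : Set M) := he ▸ by simp
    simpa using this
  have hy : y' = x ∨ y' = y ∨ y' = z := by
    have : y' ∈ ({x, y, z} : Set M) := he ▸ by simp
    simpa using this
  have hz : z' = x ∨ z' = y ∨ z' = z := by
    have : z' ∈ ({x, y, z} : Set M) := he ▸ by simp
    simpa using this
  have h1 : x = x' ∨ x = y' ∨ x = z' := by
    have : x ∈ ({x', y', z'} : Set M) := he ▸ by simp
    simpa using this
  have h2 : y = x' ∨ y = y' ∨ y = z' := by
    have : y ∈ ({x', y', z'} : Set M) := he ▸ by simp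
    simpa using this
  have h3 : z = x' ∨ z = y' ∨ z = z' := by
    have : z ∈ ({x', y', z'} : Set M) := he ▸ by simp
    simpa using this
  have p1 := (hT.symm _ _ _ h).1
  have p2 := (hT.symm _ _ _ h).2
  have p3 := (hT.symm _ _ _ p1).2
  have p4 := (hT.symm _ _ _ p2).1
  have p5 := (hT.symm _ _ _ p3).1
  clear he
  rcases hx with rfl | rfl | rfl <;> rcases hy with rfl | rfl | rfl <;>
    rcases hz with rfl | rfl | rfl <;> first | assumption | (exfalso; grind)

theorem IsHypergraph.mem_hyperedges {U : Set M} {T : M → M → M → Prop} (hT : IsHypergraph U T)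
    {x y z : M} : ({x, y, z} : Set M) ∈ hyperedges T ↔ T x y z :=
  ⟨fun ⟨_, _, _, h, he⟩ => hT.rel_of_set_eq h he, fun h => ⟨x, y, z, h, rfl⟩⟩

theorem ncard_triple {x y z : M} (hxy : x ≠ y) (hyz : y ≠ z) (hxz : x ≠ z) :
    ({x, y, z} : Set M).ncard = 3 :=
  Set.ncard_eq_three.2 ⟨x, y, z, hxy, hxz, hyz, rfl⟩

theorem IsHypergraph.ncard_eq {U : Set M} {T : M → M → M → Prop} (hT : IsHypergraph U T)
    {h : Set M} (hh : h ∈ hyperedges T) : h.ncard = 3 := by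
  obtain ⟨x, y, z, h, rfl⟩ := hh
  obtain ⟨h1, h2, h3⟩ := hT.ne _ _ _ h
  exact ncard_triple h1 h2 h3

/-- The nested equivalence of three truth values is true exactly if an odd number of them are true;
this is the first-order form of parity. -/
theorem odd_ncard_inter {x y z : M} (hxy : x ≠ y) (hyz : y ≠ z) (hxz : x ≠ z) (X : Set M) :
    Odd (({x, y, z} : Set M) ∩ X).ncard ↔ (x ∈ X ↔ (y ∈ X ↔ z ∈ X)) := by
  have hp : ∀ a b : M, a ≠ b → ({a, b} : Set M).ncard = 2 := fun a b => Set.ncard_pair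
  by_cases hx : x ∈ X <;> by_cases hy : y ∈ X <;> by_cases hz : z ∈ X <;>
    simp [Set.insert_inter_of_mem, Set.insert_inter_of_notMem, hx, hy, hz, hp _ _ hxy, hp _ _ hyz,
      hp _ _ hxz, ncard_triple hxy hyz hxz]
  decide

end Hyperedges

/-! ### Automorphisms of odd 4-multipedes. -/

section Rigid

variable {M : Type*} {E : M → M → Prop} {T : M → M → M → Prop} {lt eps : M → M → Prop}

theorem IsOneMultipede.eq_of_rel {U : Set M} (h : IsOneMultipede U E) {x y y' : M} (h1 : E x y)
    (h2 : E x y') : y = y' :=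
  (h.foot x ⟨y, h1⟩).unique h1 h2

theorem IsOneMultipede.exists_feet {U : Set M} (h : IsOneMultipede U E) {s : M}
    (hs : s ∈ segments E) : ∃ a b, a ≠ b ∧ E a s ∧ E b s ∧ ∀ c, E c s → c = a ∨ c = b := by
  obtain ⟨a, b, hab, he⟩ := Set.ncard_eq_two.1 (h.segment s hs)
  have hm : ∀ c, E c s ↔ c = a ∨ c = b := fun c => by
    have := Set.ext_iff.1 he c
    simpa using this
  exact ⟨a, b, hab, (hm a).2 (Or.inl rfl), (hm b).2 (Or.inr rfl), fun c hc => (hm c).1 hc⟩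

/-- A slave of a segment hyperedge has exactly one foot at each of the segments. -/
theorem IsTwoMinusMultipede.slave_foot_unique {U : Set M} (h : IsTwoMinusMultipede U E T)
    {X A : Set M} (hX : X ∈ hyperedges T) (hA : IsSlave E X A) {a b s : M} (ha : a ∈ A)
    (hb : b ∈ A) (has : E a s) (hbs : E b s) : a = b := by
  have hX3 := h.hypergraph.ncard_eq hX
  obtain ⟨hAf, hA3, hAX⟩ := hA
  choose! S hS using fun x (hx : x ∈ feet E) => hx
  have himg : S '' A = X := by
    rw [← hAX]
    ext y
    constructor
    · rintro ⟨x, hx, rfl⟩; exact ⟨x, hx, hS x (hAf hx)⟩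
    · rintro ⟨x, hx, hy⟩; exact ⟨x, hx, h.oneMultipede.eq_of_rel (hS x (hAf hx)) hy⟩
  have hfin : A.Finite := Set.finite_of_ncard_ne_zero (by omega)
  have hinj : Set.InjOn S A := (Set.ncard_image_iff hfin).1 (by rw [himg, hX3, hA3])
  refine hinj ha hb ?_
  rw [h.oneMultipede.eq_of_rel (hS a (hAf ha)) has, h.oneMultipede.eq_of_rel (hS b (hAf hb)) hbs]

/-- A permutation of a finite set that preserves a strict linear order of a subset fixes the
elements of the subset. -/
theorem perm_eq_of_lt_invariant [Finite M] {S : Set M} (θ : Equiv.Perm M) (hS : ∀ x ∈ S, θ x ∈ S)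
    (hlt : ∀ x y, lt x y → lt (θ x) (θ y)) (irrefl : ∀ x, ¬ lt x x)
    (trans : ∀ x y z, lt x y → lt y z → lt x z)
    (total : ∀ x ∈ S, ∀ y ∈ S, x = y ∨ lt x y ∨ lt y x) {x : M} (hx : x ∈ S) : θ x = x := by
  have hord : θ ^ orderOf θ = 1 := pow_orderOf_eq_one θ
  have hpos : 0 < orderOf θ := orderOf_pos θ
  rcases total x hx _ (hS x hx) with h | h | h
  · exact h.symm
  -- Iterating `lt x (θ x)` up to the order of `θ` would yield `lt x x`.
  · have key : ∀ n, lt x ((θ ^ (n + 1)) x) := by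
      intro n
      induction n with
      | zero => simpa using h
      | succ n ih =>
        rw [pow_succ']
        exact trans _ _ _ h (hlt _ _ ih)
    have := key (orderOf θ - 1)
    rw [Nat.sub_add_cancel hpos, hord] at this
    exact absurd this (irrefl _)
  · have key : ∀ n, lt ((θ ^ (n + 1)) x) x := by
      intro n
      induction n with
      | zero => simpa using h
      | succ n ih =>
        rw [pow_succ']
        exact trans _ _ _ (hlt _ _ ih) h
    have := key (orderOf θ - 1)
    rw [Nat.sub_add_cancel hpos, hord] at this
    exact absurd this (irrefl _)

open Classical in
theorem swap_swap_segment {a a' b b' s t c r : M} (hs : E a s) (hs' : E a' s) (ht : E b t)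
    (ht' : E b' t) (huniq : ∀ x y y', E x y → E x y' → y = y') (hc : E c r) :
    E (Equiv.swap a a' (Equiv.swap b b' c)) r := by
  have key : ∀ (d d' p : M), E d p → E d' p → ∀ c, E c r → E (Equiv.swap d d' c) r := by
    intro d d' p hd hd' c hc
    rw [Equiv.swap_apply_def]
    split_ifs with h1 h2
    · subst h1; rwa [huniq _ _ _ hc hd]
    · subst h2; rwa [huniq _ _ _ hc hd']
    · exact hc
  exact key _ _ _ hs hs' _ (key _ _ _ ht ht' _ hc)

-- Since `s ≠ t`, the two transpositions move disjoint pairs of feet and cannot undo one another.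
open Classical in
theorem swap_swap_eq_iff {a a' b b' s t c r : M} (hst : s ≠ t) (haa : a ≠ a') (hbb : b ≠ b')
    (hs : E a s) (hs' : E a' s) (ht : E b t)
    (ht' : E b' t) (huniq : ∀ x y y', E x y → E x y' → y = y')
    (hfeet : ∀ d d' p, d ≠ d' → E d p → E d' p → ∀ c, E c p → c = d ∨ c = d') (hc : E c r) :
    Equiv.swap a a' (Equiv.swap b b' c) = c ↔ r ≠ s ∧ r ≠ t := by
  by_cases hrt : r = t
  · subst hrt
    have h1 : ∀ x, E x r → x ≠ a ∧ x ≠ a' := fun x hx =>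
      ⟨fun h => hst (huniq _ _ _ (h ▸ hs) hx), fun h => hst (huniq _ _ _ (h ▸ hs') hx)⟩
    rcases hfeet _ _ _ hbb ht ht' c hc with rfl | rfl
    · rw [Equiv.swap_apply_left, Equiv.swap_apply_of_ne_of_ne (h1 _ ht').1 (h1 _ ht').2]
      simp [hbb.symm]
    · rw [Equiv.swap_apply_right, Equiv.swap_apply_of_ne_of_ne (h1 _ ht).1 (h1 _ ht).2]
      simp [hbb]
  · have hcb : c ≠ b := fun h => hrt (huniq _ _ _ hc (h ▸ ht))
    have hcb' : c ≠ b' := fun h => hrt (huniq _ _ _ hc (h ▸ ht'))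
    rw [Equiv.swap_apply_of_ne_of_ne hcb hcb']
    by_cases hrs : r = s
    · subst hrs
      rcases hfeet _ _ _ haa hs hs' c hc with rfl | rfl
      · simp [haa.symm]
      · simp [haa]
    · have hca : c ≠ a := fun h => hrs (huniq _ _ _ hc (h ▸ hs))
      have hca' : c ≠ a' := fun h => hrs (huniq _ _ _ hc (h ▸ hs'))
      rw [Equiv.swap_apply_of_ne_of_ne hca hca']
      simp [hrs, hrt]

/-- An automorphism maps a positive slave of a segment hyperedge to a positive slave of the same
hyperedge, and equivalent slaves differ at zero or two segments. So the set of segments whose feet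
are exchanged meets every segment hyperedge evenly, and oddness makes it empty. -/
theorem IsFourMultipede.perm_eq [Finite M] (h : IsFourMultipede E T lt eps)
    (hodd : IsOdd (segments E) T) (θ : Equiv.Perm M) (hE : ∀ x y, E (θ x) (θ y) ↔ E x y)
    (hT : ∀ x y z, T (θ x) (θ y) (θ z) ↔ T x y z) (hlt : ∀ x y, lt (θ x) (θ y) ↔ lt x y)
    (heps : ∀ x y, eps (θ x) (θ y) ↔ eps x y) (x : M) : θ x = x := by
  obtain ⟨⟨⟨⟨h1, hhyp, hunif, hproj⟩, hfour, hequiv⟩, lt_mem, irrefl, trans, total⟩, eps_mem, hrep⟩ := h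
  have h2m : IsTwoMinusMultipede _ E T := ⟨h1, hhyp, hunif, hproj⟩
  have hSmem : ∀ s, θ s ∈ segments E ↔ s ∈ segments E := by
    intro s
    constructor
    · rintro ⟨f, hf⟩
      exact ⟨θ.symm f, by rw [← hE]; simpa using hf⟩
    · rintro ⟨f, hf⟩
      exact ⟨θ f, (hE _ _).2 hf⟩
  have hFmem : ∀ s, θ s ∈ feet E ↔ s ∈ feet E := by
    intro s
    constructor
    · rintro ⟨f, hf⟩
      exact ⟨θ.symm f, by rw [← hE]; simpa using hf⟩
    · rintro ⟨f, hf⟩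
      exact ⟨θ f, (hE _ _).2 hf⟩
  have hseg : ∀ s ∈ segments E, θ s = s := fun s hs =>
    perm_eq_of_lt_invariant θ (fun x hx => (hSmem x).2 hx) (fun x y => (hlt x y).2) irrefl trans
      total hs
  have hEs : ∀ {c s}, E c s → E (θ c) s := fun {c s} hc => by
    have := (hE c s).2 hc
    rwa [hseg s ⟨c, hc⟩] at this
  have hfeet : ∀ d d' p, d ≠ d' → E d p → E d' p → ∀ c, E c p → c = d ∨ c = d' := by
    intro d d' p hne hd hd' c hc
    obtain ⟨a, b, _, _, _, hall⟩ := h1.exists_feet ⟨d, hd⟩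
    rcases hall d hd with rfl | rfl <;> rcases hall d' hd' with rfl | rfl <;>
      rcases hall c hc with rfl | rfl <;> simp_all
  by_cases hxf : x ∈ feet E
  · by_contra hmove
    obtain ⟨s, hs⟩ := hxf
    let D : Set M := {s | s ∈ segments E ∧ ∀ c, E c s → θ c ≠ c}
    have hD : ∀ {c s}, E c s → (s ∈ D ↔ θ c ≠ c) := by
      intro c s hc
      refine ⟨fun hs => hs.2 c hc, fun hne => ⟨⟨c, hc⟩, fun c' hc' heq => ?_⟩⟩
      have hcc : c' ≠ c := fun h => hne (h ▸ heq)
      rcases hfeet c' c s hcc hc' hc (θ c) (hEs hc) with h | h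
      · exact hcc (θ.injective (heq.trans h.symm))
      · exact hne h
    obtain ⟨X, hX, hXs, hXD⟩ := hodd D (fun s hs => hs.1) ⟨s, (hD hs).2 hmove⟩
    have h4 := hfour X hX hXs
    obtain ⟨A, hA⟩ : (positiveSlaves E T X).Nonempty :=
      Set.nonempty_of_ncard_ne_zero (by omega)
    have hAB : θ '' A ∈ positiveSlaves E T X := by
      obtain ⟨⟨hAf, hA3, hAX⟩, a, b, c, habc, rfl⟩ := hA
      refine ⟨⟨?_, ?_, ?_⟩, θ a, θ b, θ c, (hT _ _ _).2 habc, by simp [Set.image_insert_eq]⟩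
      · rintro _ ⟨y, hy, rfl⟩
        exact (hFmem y).2 (hAf hy)
      · rw [Set.ncard_image_of_injective _ θ.injective, hA3]
      · rw [← hAX]
        ext y
        constructor
        · rintro ⟨_, ⟨z, hz, rfl⟩, hy⟩
          refine ⟨z, hz, ?_⟩
          obtain ⟨y', hy'⟩ := hAf hz
          rwa [h1.eq_of_rel hy (hEs hy')]
        · rintro ⟨z, hz, hy⟩
          exact ⟨θ z, ⟨z, hz, rfl⟩, hEs hy⟩
    have hfoot : ∀ r ∈ X, ∃ c ∈ A, E c r := by
      intro r hr
      rw [← hA.1.2.2] at hr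
      exact hr
    have hBuniq := fun {a b s} => h2m.slave_foot_unique hX hAB.1 (a := a) (b := b) (s := s)
    -- A slave has only one foot at each segment, so the equality of sets determines the image of
    -- each single foot: `X ∩ D` is empty in the first case and `{s, t}` in the second.
    rcases hequiv X hX hXs A hA _ hAB with heq | ⟨s, hs, t, ht, hst, a, a', b, b', haa, has, has',
      hbb, hbt, hbt', heq⟩
    · have : X ∩ D = ∅ := by
        rw [Set.eq_empty_iff_forall_notMem]
        rintro r ⟨hr, hrD⟩
        obtain ⟨c, hc, hcr⟩ := hfoot r hr
        refine (hD hcr).1 hrD ?_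
        exact hBuniq (Set.mem_image_of_mem _ hc) (heq ▸ hc) (hEs hcr) hcr
      rw [this] at hXD
      simp at hXD
    · have : X ∩ D = {s, t} := by
        have hmem : ∀ r ∈ X, (r ∈ D ↔ r = s ∨ r = t) := by
          intro r hr
          obtain ⟨c, hc, hcr⟩ := hfoot r hr
          have huniq : ∀ x y y', E x y → E x y' → y = y' := fun x y y' => h1.eq_of_rel
          have hσ := swap_swap_segment has has' hbt hbt' huniq hcr
          have hθσ : θ c = _ := hBuniq (Set.mem_image_of_mem _ hc)
            (heq ▸ Set.mem_image_of_mem _ hc) (hEs hcr) hσ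
          rw [hD hcr, hθσ, ne_eq, swap_swap_eq_iff hst haa hbb has has' hbt hbt' huniq hfeet hcr]
          tauto
        ext r
        constructor
        · rintro ⟨hr, hrD⟩
          exact (hmem r hr).1 hrD
        · rintro (rfl | rfl)
          · exact ⟨hs, (hmem _ hs).2 (Or.inl rfl)⟩
          · exact ⟨ht, (hmem _ ht).2 (Or.inr rfl)⟩
      rw [this, Set.ncard_pair hst] at hXD
      exact absurd hXD (by decide)
  · by_cases hxs : x ∈ segments E
    · exact hseg x hxs
    · have hnot : x ∉ feet E ∪ segments E := by simp [hxf, hxs]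
      refine (hrep {y | eps y x} fun y hy => (eps_mem _ _ hy).1).unique ⟨?_, fun y => ?_⟩
        ⟨hnot, fun y => Iff.rfl⟩
      · rintro (h | h)
        · exact hxf ((hFmem x).1 h)
        · exact hxs ((hSmem x).1 h)
      · constructor
        · intro hy
          have hys := (eps_mem _ _ hy).1
          rwa [← hseg y hys, heps] at hy
        · intro hy
          have hys := (eps_mem _ _ hy).1
          rw [← hseg y hys, heps]
          exact hy

theorem isRigid_of_isOddFourMultipede (M : Type w) [vocabulary.Structure M] [Finite M]
    (h : IsOddFourMultipede M) : IsRigid vocabulary M := by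
  intro θ
  have h2 : ∀ (R : vocabulary.Relations 2) x y, FirstOrder.Language.Structure.RelMap R ![θ x, θ y] ↔
      FirstOrder.Language.Structure.RelMap R ![x, y] := fun R x y => by
    rw [← θ.map_rel R ![x, y] ]
    refine iff_of_eq (congrArg _ ?_)
    funext i
    fin_cases i <;> rfl
  have h3 : ∀ (R : vocabulary.Relations 3) x y z,
      FirstOrder.Language.Structure.RelMap R ![θ x, θ y, θ z] ↔
      FirstOrder.Language.Structure.RelMap R ![x, y, z] := fun R x y z => by
    rw [← θ.map_rel R ![x, y, z] ]
    refine iff_of_eq (congrArg _ ?_)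
    funext i
    fin_cases i <;> rfl
  exact h.1.perm_eq h.2 θ.toEquiv (h2 Symbol.edge) (h3 Symbol.hyper) (h2 Symbol.less)
    (h2 Symbol.contain)

end Rigid

end Multipede

/-! ## First-order definability -/

namespace Multipede

section Definability

open FirstOrder FirstOrder.Language

/-- The relation `P` on `n`-tuples is defined by one first-order formula in all structures. -/
def FODefinable (n : ℕ) (P : ∀ (M : Type w) [vocabulary.Structure M], (Fin n → M) → Prop) : Prop :=
  ∃ φ : vocabulary.BoundedFormula Empty n, ∀ (M : Type w) [vocabulary.Structure M] (v : Fin n → M),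
    φ.Realize default v ↔ P M v

namespace FODefinable

variable {n : ℕ} {P Q : ∀ (M : Type w) [vocabulary.Structure M], (Fin n → M) → Prop}

theorem not (hP : FODefinable n P) : FODefinable n fun M _ v => ¬ P M v := by
  obtain ⟨φ, hφ⟩ := hP
  exact ⟨φ.not, fun M _ v => by rw [BoundedFormula.realize_not, hφ]⟩

theorem and (hP : FODefinable n P) (hQ : FODefinable n Q) :
    FODefinable n fun M _ v => P M v ∧ Q M v := by
  obtain ⟨φ, hφ⟩ := hP
  obtain ⟨ψ, hψ⟩ := hQ
  exact ⟨φ ⊓ ψ, fun M _ v => by rw [BoundedFormula.realize_inf, hφ, hψ]⟩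

theorem or (hP : FODefinable n P) (hQ : FODefinable n Q) :
    FODefinable n fun M _ v => P M v ∨ Q M v := by
  obtain ⟨φ, hφ⟩ := hP
  obtain ⟨ψ, hψ⟩ := hQ
  exact ⟨φ ⊔ ψ, fun M _ v => by rw [BoundedFormula.realize_sup, hφ, hψ]⟩

theorem imp (hP : FODefinable n P) (hQ : FODefinable n Q) :
    FODefinable n fun M _ v => P M v → Q M v := by
  obtain ⟨φ, hφ⟩ := hP
  obtain ⟨ψ, hψ⟩ := hQ
  exact ⟨φ.imp ψ, fun M _ v => by rw [BoundedFormula.realize_imp, hφ, hψ]⟩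

theorem iff (hP : FODefinable n P) (hQ : FODefinable n Q) :
    FODefinable n fun M _ v => P M v ↔ Q M v := by
  obtain ⟨φ, hφ⟩ := hP
  obtain ⟨ψ, hψ⟩ := hQ
  exact ⟨φ.iff ψ, fun M _ v => by rw [BoundedFormula.realize_iff, hφ, hψ]⟩

theorem all {P : ∀ (M : Type w) [vocabulary.Structure M], (Fin n → M) → M → Prop}
    (hP : FODefinable (n + 1) fun M _ v => P M (fun i => v i.castSucc) (v (Fin.last n))) :
    FODefinable n fun M _ v => ∀ x, P M v x := by
  obtain ⟨φ, hφ⟩ := hP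
  refine ⟨φ.all, fun M _ v => ?_⟩
  rw [BoundedFormula.realize_all]
  refine forall_congr' fun x => ?_
  rw [hφ]
  simp

theorem ex {P : ∀ (M : Type w) [vocabulary.Structure M], (Fin n → M) → M → Prop}
    (hP : FODefinable (n + 1) fun M _ v => P M (fun i => v i.castSucc) (v (Fin.last n))) :
    FODefinable n fun M _ v => ∃ x, P M v x := by
  obtain ⟨φ, hφ⟩ := hP
  refine ⟨φ.ex, fun M _ v => ?_⟩
  rw [BoundedFormula.realize_ex]
  refine exists_congr fun x => ?_
  rw [hφ]
  simp

theorem eq (i j : Fin n) : FODefinable.{w} n fun _ _ v => v i = v j :=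
  ⟨(&i).bdEqual &j, fun M _ v => by simp⟩

theorem rel₂ (R : vocabulary.Relations 2) (i j : Fin n) :
    FODefinable.{w} n fun _ _ v => Structure.RelMap R ![v i, v j] :=
  ⟨R.boundedFormula₂ (&i) &j, fun M _ v => by simp [BoundedFormula.realize_rel₂]⟩

theorem rel₃ (R : vocabulary.Relations 3) (i j k : Fin n) :
    FODefinable.{w} n fun _ _ v => Structure.RelMap R ![v i, v j, v k] :=
  ⟨R.boundedFormula ![&i, &j, &k], fun M _ v => by
    rw [BoundedFormula.realize_rel]
    refine iff_of_eq (congrArg _ ?_)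
    funext l
    fin_cases l <;> rfl⟩

end FODefinable

theorem finitelyAxiomatizable_of_foDefinable {K : ∀ (M : Type w) [vocabulary.Structure M], Prop}
    {P : ∀ (M : Type w) [vocabulary.Structure M], Prop} (hP : FODefinable 0 fun M _ _ => P M)
    (h : ∀ (M : Type w) [vocabulary.Structure M] [Finite M], K M ↔ P M) :
    FinitelyAxiomatizable K := by
  obtain ⟨φ, hφ⟩ := hP
  refine ⟨{φ}, Set.finite_singleton _, fun M _ _ => ?_⟩
  rw [Theory.model_singleton_iff, h]
  exact hφ M default

end Definability

/-! ## First-order axioms of odd 4-multipedes -/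

section Axioms

variable {M : Type w} (E : M → M → Prop) (T : M → M → M → Prop) (lt eps : M → M → Prop)

def AxOne : Prop :=
  (∀ x, ¬ ((∃ y, E x y) ∧ ∃ y, E y x)) ∧ (∀ x y y', E x y → E x y' → y = y') ∧
  ∀ y, (∃ x, E x y) → ∃ a b, ¬ a = b ∧ ∀ c, E c y ↔ (c = a ∨ c = b)

theorem axOne_iff : AxOne E ↔ IsOneMultipede (feet E ∪ segments E) E := by
  constructor
  · rintro ⟨h1, h2, h3⟩
    refine ⟨Set.eq_empty_iff_forall_notMem.2 h1, rfl, ?_, ?_⟩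
    · rintro x ⟨y, hy⟩
      exact ⟨y, hy, fun y' hy' => h2 x y' y hy' hy⟩
    · intro y hy
      obtain ⟨a, b, hab, h⟩ := h3 y hy
      exact Set.ncard_eq_two.2 ⟨a, b, hab, Set.ext h⟩
  · intro h
    refine ⟨Set.eq_empty_iff_forall_notMem.1 h.disjoint, fun x y y' => h.eq_of_rel, ?_⟩
    intro y hy
    obtain ⟨a, b, hab, he⟩ := Set.ncard_eq_two.1 (h.segment y hy)
    exact ⟨a, b, hab, Set.ext_iff.1 he⟩

def AxHyper : Prop :=
  (∃ x, (∃ y, E x y) ∨ ∃ y, E y x) ∧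
  (∀ x y z, T x y z → ((∃ y, E x y) ∨ ∃ y, E y x) ∧ ((∃ z, E y z) ∨ ∃ z, E z y) ∧
    ((∃ y, E z y) ∨ ∃ y, E y z)) ∧
  (∀ x y z, T x y z → ¬ x = y ∧ ¬ y = z ∧ ¬ x = z) ∧
  (∀ x y z, T x y z → T y x z ∧ T x z y)

theorem axHyper_iff : AxHyper E T ↔ IsHypergraph (feet E ∪ segments E) T :=
  ⟨fun ⟨h1, h2, h3, h4⟩ => ⟨h1, h2, h3, h4⟩, fun ⟨h1, h2, h3, h4⟩ => ⟨h1, h2, h3, h4⟩⟩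

/-- `p, q, r` are the segments of `a, b, c`. -/
def SegmentsEq (a b c p q r : M) : Prop :=
  ∀ y, (E a y ∨ E b y ∨ E c y) ↔ (y = p ∨ y = q ∨ y = r)

theorem segmentsEq_iff (a b c p q r : M) :
    SegmentsEq E a b c p q r ↔ segmentsOf E {a, b, c} = {p, q, r} := by
  rw [Set.ext_iff]
  refine forall_congr' fun y => ?_
  simp [segmentsOf]

def AxTwoMinus : Prop :=
  (∀ x y z, T x y z → ((∃ a, E a x) ∧ (∃ a, E a y) ∧ ∃ a, E a z) ∨
    ((∃ a, E x a) ∧ (∃ a, E y a) ∧ ∃ a, E z a)) ∧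
  ∀ x y z, T x y z → ((∃ a, E x a) ∧ (∃ a, E y a) ∧ ∃ a, E z a) →
    ∃ p q r, T p q r ∧ SegmentsEq E x y z p q r

theorem triple_subset (S : Set M) (x y z : M) :
    ({x, y, z} : Set M) ⊆ S ↔ x ∈ S ∧ y ∈ S ∧ z ∈ S := by
  simp [Set.insert_subset_iff]

theorem axTwoMinus_iff : AxOne E ∧ AxHyper E T ∧ AxTwoMinus E T ↔
    IsTwoMinusMultipede (feet E ∪ segments E) E T := by
  rw [axOne_iff, axHyper_iff]
  constructor
  · rintro ⟨h1, h2, h3, h4⟩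
    refine ⟨h1, h2, ?_, ?_⟩
    · rintro _ ⟨x, y, z, h, rfl⟩
      rw [triple_subset, triple_subset]
      exact h3 x y z h
    · rintro _ ⟨x, y, z, h, rfl⟩ hf
      rw [triple_subset] at hf
      obtain ⟨p, q, r, h, he⟩ := h4 x y z h hf
      exact ⟨p, q, r, h, (segmentsEq_iff _ _ _ _ _ _ _).1 he⟩
  · rintro ⟨h1, h2, h3, h4⟩
    refine ⟨h1, h2, ?_, ?_⟩
    · intro x y z h
      have := h3 _ ⟨x, y, z, h, rfl⟩
      rwa [triple_subset, triple_subset] at this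
    · intro x y z h hf
      obtain ⟨p, q, r, h, he⟩ := h4 _ ⟨x, y, z, h, rfl⟩ ((triple_subset _ _ _ _).2 hf)
      exact ⟨p, q, r, h, (segmentsEq_iff _ _ _ _ _ _ _).2 he⟩

/-- `a, b, c` form a positive slave of `p, q, r`. -/
def PosSlave (p q r a b c : M) : Prop :=
  T a b c ∧ ((∃ y, E a y) ∧ (∃ y, E b y) ∧ ∃ y, E c y) ∧ SegmentsEq E a b c p q r

variable {E T} in
theorem mem_positiveSlaves_iff {U : Set M} (hT : IsHypergraph U T) (p q r : M) (A : Set M) :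
    A ∈ positiveSlaves E T {p, q, r} ↔ ∃ a b c, PosSlave E T p q r a b c ∧ A = {a, b, c} := by
  constructor
  · rintro ⟨⟨h1, h2, h3⟩, a, b, c, h, rfl⟩
    exact ⟨a, b, c, ⟨h, (triple_subset (feet E) _ _ _).1 h1, (segmentsEq_iff _ _ _ _ _ _ _).2 h3⟩, rfl⟩
  · rintro ⟨a, b, c, ⟨h, h1, h3⟩, rfl⟩
    exact ⟨⟨(triple_subset _ _ _ _).2 h1, hT.ncard_eq ⟨a, b, c, h, rfl⟩,
      (segmentsEq_iff _ _ _ _ _ _ _).1 h3⟩, a, b, c, h, rfl⟩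

def SameTriple (a b c a' b' c' : M) : Prop :=
  ∀ x, (x = a ∨ x = b ∨ x = c) ↔ (x = a' ∨ x = b' ∨ x = c')

theorem sameTriple_iff (a b c a' b' c' : M) :
    SameTriple a b c a' b' c' ↔ ({a, b, c} : Set M) = {a', b', c'} :=
  Set.ext_iff.symm

def SwapEq (a a' x y : M) : Prop :=
  (x = a ∧ y = a') ∨ (x = a' ∧ y = a) ∨ (¬ x = a ∧ ¬ x = a' ∧ x = y)

open Classical in
theorem swapEq_iff (a a' x y : M) : SwapEq a a' x y ↔ Equiv.swap a a' x = y := by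
  rw [Equiv.swap_apply_def, SwapEq]
  grind

def SlaveEquivTriple (p q r a b c a' b' c' : M) : Prop :=
  SameTriple a b c a' b' c' ∨ ∃ s, (s = p ∨ s = q ∨ s = r) ∧ ∃ t, (t = p ∨ t = q ∨ t = r) ∧ ¬ s = t ∧
    ∃ d d' e e', ¬ d = d' ∧ E d s ∧ E d' s ∧ ¬ e = e' ∧ E e t ∧ E e' t ∧
      ∀ y, (y = a' ∨ y = b' ∨ y = c') ↔
        ∃ x, (x = a ∨ x = b ∨ x = c) ∧ ∃ z, SwapEq e e' x z ∧ SwapEq d d' z y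

theorem slaveEquivTriple_iff (p q r a b c a' b' c' : M) :
    SlaveEquivTriple E p q r a b c a' b' c' ↔ SlaveEquiv E {p, q, r} {a, b, c} {a', b', c'} := by
  classical
  rw [SlaveEquivTriple, SlaveEquiv, sameTriple_iff]
  refine or_congr_right ?_
  refine exists_congr fun s => and_congr_right fun _ => exists_congr fun t => and_congr_right fun _ =>
    and_congr_right fun _ => exists_congr fun d => exists_congr fun d' => exists_congr fun e =>
    exists_congr fun e' => and_congr_right fun _ => and_congr_right fun _ => and_congr_right fun _ =>
    and_congr_right fun _ => and_congr_right fun _ => and_congr_right fun _ => ?_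
  rw [Set.ext_iff]
  refine forall_congr' fun y => iff_congr Iff.rfl ?_
  simp only [swapEq_iff, exists_eq_left']
  rfl

theorem ncard_eq_four_iff {α : Type*} (S : Set α) : S.ncard = 4 ↔
    ∃ A ∈ S, ∃ B ∈ S, ∃ C ∈ S, ∃ D ∈ S, (¬ A = B ∧ ¬ A = C ∧ ¬ A = D ∧ ¬ B = C ∧ ¬ B = D ∧ ¬ C = D) ∧
      ∀ X ∈ S, X = A ∨ X = B ∨ X = C ∨ X = D := by
  constructor
  · intro h
    have hfin : S.Finite := Set.finite_of_ncard_ne_zero (by omega)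
    obtain ⟨A, S₁, hA, rfl, h1⟩ := (Set.ncard_eq_succ hfin).1 h
    obtain ⟨B, C, D, hBC, hBD, hCD, rfl⟩ := Set.ncard_eq_three.1 h1
    simp only [Set.mem_insert_iff, Set.mem_singleton_iff, not_or] at hA
    refine ⟨A, by simp, B, by simp, C, by simp, D, by simp, ⟨hA.1, hA.2.1, hA.2.2, hBC, hBD, hCD⟩, ?_⟩
    intro X hX
    simpa using hX
  · rintro ⟨A, hA, B, hB, C, hC, D, hD, ⟨h1, h2, h3, h4, h5, h6⟩, hall⟩
    have : S = {A, B, C, D} := by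
      ext X
      constructor
      · intro hX; simpa using hall X hX
      · rintro (rfl | rfl | rfl | rfl) <;> assumption
    rw [this, Set.ncard_insert_of_notMem (by simp [h1, h2, h3]) (Set.toFinite _),
      ncard_triple h4 h6 h5]

def AxTwo : Prop :=
  (∀ p q r, T p q r → ((∃ x, E x p) ∧ (∃ x, E x q) ∧ ∃ x, E x r) →
    ∃ a b c, PosSlave E T p q r a b c ∧ ∃ a' b' c', PosSlave E T p q r a' b' c' ∧
    ∃ d e f, PosSlave E T p q r d e f ∧ ∃ d' e' f', PosSlave E T p q r d' e' f' ∧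
    (¬ SameTriple a b c a' b' c' ∧ ¬ SameTriple a b c d e f ∧ ¬ SameTriple a b c d' e' f' ∧
      ¬ SameTriple a' b' c' d e f ∧ ¬ SameTriple a' b' c' d' e' f' ∧ ¬ SameTriple d e f d' e' f') ∧
    ∀ x y z, PosSlave E T p q r x y z → SameTriple x y z a b c ∨ SameTriple x y z a' b' c' ∨
      SameTriple x y z d e f ∨ SameTriple x y z d' e' f') ∧
  (∀ p q r, T p q r → ((∃ x, E x p) ∧ (∃ x, E x q) ∧ ∃ x, E x r) →
    ∀ a b c, PosSlave E T p q r a b c → ∀ a' b' c', PosSlave E T p q r a' b' c' →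
      SlaveEquivTriple E p q r a b c a' b' c')

theorem axTwo_iff : (AxOne E ∧ AxHyper E T ∧ AxTwoMinus E T) ∧ AxTwo E T ↔
    IsTwoMultipede (feet E ∪ segments E) E T := by
  rw [axTwoMinus_iff]
  refine Iff.trans (and_congr_right fun h => ?_)
    (⟨fun ⟨h1, h2, h3⟩ => ⟨h1, h2, h3⟩, fun ⟨h1, h2, h3⟩ => ⟨h1, h2, h3⟩⟩ :
      IsTwoMinusMultipede (feet E ∪ segments E) E T ∧
      ((∀ X ∈ hyperedges T, X ⊆ segments E → (positiveSlaves E T X).ncard = 4) ∧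
      ∀ X ∈ hyperedges T, X ⊆ segments E →
        ∀ A ∈ positiveSlaves E T X, ∀ B ∈ positiveSlaves E T X, SlaveEquiv E X A B) ↔ _)
  have hmem := fun p q r A => mem_positiveSlaves_iff (E := E) h.hypergraph p q r A
  have hquant : ∀ P : Set M → Prop, (∀ X ∈ hyperedges T, X ⊆ segments E → P X) ↔
      ∀ p q r, T p q r → ((∃ x, E x p) ∧ (∃ x, E x q) ∧ ∃ x, E x r) → P {p, q, r} := by
    intro P
    constructor
    · intro h p q r hT hs
      exact h _ ⟨p, q, r, hT, rfl⟩ ((triple_subset _ _ _ _).2 hs)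
    · rintro h _ ⟨p, q, r, hT, rfl⟩ hs
      exact h p q r hT ((triple_subset (segments E) _ _ _).1 hs)
  rw [hquant, hquant, AxTwo]
  refine and_congr ?_ ?_
  · refine forall_congr' fun p => forall_congr' fun q => forall_congr' fun r => forall_congr' fun _ =>
      forall_congr' fun _ => ?_
    rw [ncard_eq_four_iff]
    have hex : ∀ P : Set M → Prop, (∃ A ∈ positiveSlaves E T {p, q, r}, P A) ↔
        ∃ a b c, PosSlave E T p q r a b c ∧ P {a, b, c} := by
      intro P
      constructor
      · rintro ⟨A, hA, hP⟩
        obtain ⟨a, b, c, h, rfl⟩ := (hmem p q r A).1 hA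
        exact ⟨a, b, c, h, hP⟩
      · rintro ⟨a, b, c, h, hP⟩
        exact ⟨_, (hmem p q r _).2 ⟨a, b, c, h, rfl⟩, hP⟩
    have hall : ∀ P : Set M → Prop, (∀ A ∈ positiveSlaves E T {p, q, r}, P A) ↔
        ∀ a b c, PosSlave E T p q r a b c → P {a, b, c} := by
      intro P
      have := hex fun A => ¬ P A
      rw [← not_iff_not]
      push Not
      exact this
    simp only [sameTriple_iff, hex, hall]
  · refine forall_congr' fun p => forall_congr' fun q => forall_congr' fun r => forall_congr' fun _ =>
      forall_congr' fun _ => ?_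
    simp only [slaveEquivTriple_iff]
    constructor
    · intro h A hA B hB
      obtain ⟨a, b, c, h1, rfl⟩ := (hmem p q r A).1 hA
      obtain ⟨a', b', c', h2, rfl⟩ := (hmem p q r B).1 hB
      exact h _ _ _ h1 _ _ _ h2
    · intro h a b c h1 a' b' c' h2
      exact h _ ((hmem p q r _).2 ⟨_, _, _, h1, rfl⟩) _ ((hmem p q r _).2 ⟨_, _, _, h2, rfl⟩)

def AxThree : Prop :=
  (∀ x y, lt x y → (∃ a, E a x) ∧ ∃ a, E a y) ∧ (∀ x, ¬ lt x x) ∧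
  (∀ x y z, lt x y → lt y z → lt x z) ∧
  ∀ x, (∃ a, E a x) → ∀ y, (∃ a, E a y) → x = y ∨ lt x y ∨ lt y x

theorem axThree_iff : ((AxOne E ∧ AxHyper E T ∧ AxTwoMinus E T) ∧ AxTwo E T) ∧ AxThree E lt ↔
    IsThreeMultipede (feet E ∪ segments E) E T lt := by
  rw [axTwo_iff]
  exact ⟨fun ⟨h, h1, h2, h3, h4⟩ => ⟨h, h1, h2, h3, h4⟩,
    fun ⟨h, h1, h2, h3, h4⟩ => ⟨h, h1, h2, h3, h4⟩⟩

/-- That every set of segments is represented is not literally first-order. The empty set and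
closure under adding one segment suffice by induction, because the structure is finite. -/
def AxFour : Prop :=
  (∀ x Y, eps x Y → (∃ a, E a x) ∧ ¬ ((∃ a, E Y a) ∨ ∃ a, E a Y)) ∧
  (∃ Y, ¬ ((∃ a, E Y a) ∨ ∃ a, E a Y) ∧ ∀ x, ¬ eps x Y) ∧
  (∀ Y, ¬ ((∃ a, E Y a) ∨ ∃ a, E a Y) → ∀ s, (∃ a, E a s) →
    ∃ Y', ¬ ((∃ a, E Y' a) ∨ ∃ a, E a Y') ∧ ∀ x, eps x Y' ↔ (eps x Y ∨ x = s)) ∧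
  ∀ Y Y', ¬ ((∃ a, E Y a) ∨ ∃ a, E a Y) → ¬ ((∃ a, E Y' a) ∨ ∃ a, E a Y') →
    (∀ x, eps x Y ↔ eps x Y') → Y = Y'

theorem axFour_iff [Finite M] :
    (((AxOne E ∧ AxHyper E T ∧ AxTwoMinus E T) ∧ AxTwo E T) ∧ AxThree E lt) ∧ AxFour E eps ↔
    IsFourMultipede E T lt eps := by
  rw [axThree_iff]
  constructor
  · rintro ⟨h, h1, h2, h3, h4⟩
    refine ⟨h, h1, fun X hX => ?_⟩
    have hex : ∃ Y, Y ∉ feet E ∪ segments E ∧ ∀ x, eps x Y ↔ x ∈ X := by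
      induction X, X.toFinite using Set.Finite.induction_on with
      | empty =>
        obtain ⟨Y, hY, he⟩ := h2
        exact ⟨Y, hY, fun x => by simp [he]⟩
      | @insert s X _ _ ih =>
        obtain ⟨Y, hY, he⟩ := ih ((Set.subset_insert s X).trans hX)
        obtain ⟨Y', hY', he'⟩ := h3 Y hY s (hX (Set.mem_insert s X))
        refine ⟨Y', hY', fun x => ?_⟩
        rw [he', he, Set.mem_insert_iff, or_comm]
    obtain ⟨Y, hY, he⟩ := hex
    exact ⟨Y, ⟨hY, he⟩, fun Y' ⟨hY', he'⟩ => h4 Y' Y hY' hY fun x => by rw [he, he']⟩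
  · rintro ⟨h, h1, h2⟩
    refine ⟨h, h1, ?_, ?_, ?_⟩
    · obtain ⟨Y, ⟨hY, he⟩, _⟩ := h2 ∅ (Set.empty_subset _)
      exact ⟨Y, hY, fun x => by simp [he]⟩
    · intro Y hY s hs
      obtain ⟨Y', ⟨hY', he⟩, _⟩ := h2 (insert s {x | eps x Y}) (by
        rintro x (rfl | hx)
        · exact hs
        · exact (h1 x Y hx).1)
      refine ⟨Y', hY', fun x => ?_⟩
      rw [he, Set.mem_insert_iff, or_comm]
      rfl
    · intro Y Y' hY hY' he
      exact (h2 {x | eps x Y} fun x hx => (h1 x Y hx).1).unique ⟨hY, fun x => Iff.rfl⟩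
        ⟨hY', fun x => (he x).symm⟩

/-- The quantifier over nonempty sets of segments becomes a quantifier over super-segments. -/
def AxOdd : Prop :=
  ∀ Y, ¬ ((∃ a, E Y a) ∨ ∃ a, E a Y) → (∃ x, eps x Y) →
    ∃ p q r, T p q r ∧ ((∃ x, E x p) ∧ (∃ x, E x q) ∧ ∃ x, E x r) ∧ (eps p Y ↔ (eps q Y ↔ eps r Y))

variable {E T lt eps} in
theorem IsFourMultipede.axOdd_iff (h : IsFourMultipede E T lt eps) :
    AxOdd E T eps ↔ IsOdd (segments E) T := by
  have hT := h.threeMultipede.twoMultipede.twoMinusMultipede.hypergraph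
  constructor
  · intro ho X hX hne
    obtain ⟨Y, ⟨hY, he⟩, _⟩ := h.represent X hX
    obtain ⟨x, hx⟩ := hne
    obtain ⟨p, q, r, hpqr, hs, hodd⟩ := ho Y hY ⟨x, (he x).2 hx⟩
    obtain ⟨h1, h2, h3⟩ := hT.ne _ _ _ hpqr
    refine ⟨_, ⟨p, q, r, hpqr, rfl⟩, (triple_subset _ _ _ _).2 hs, ?_⟩
    rw [odd_ncard_inter h1 h2 h3, ← he, ← he, ← he]
    exact hodd
  · intro ho Y hY hne
    obtain ⟨_, ⟨p, q, r, hpqr, rfl⟩, hs, hodd⟩ :=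
      ho {x | eps x Y} (fun x hx => (h.eps_mem x Y hx).1) hne
    obtain ⟨h1, h2, h3⟩ := hT.ne _ _ _ hpqr
    rw [odd_ncard_inter h1 h2 h3] at hodd
    exact ⟨p, q, r, hpqr, (triple_subset (segments E) _ _ _).1 hs, hodd⟩

end Axioms

open FirstOrder.Language in
theorem finitelyAxiomatizable_isOddFourMultipede :
    FinitelyAxiomatizable.{w} IsOddFourMultipede := by
  have key : ∀ (M : Type w) [vocabulary.Structure M] [Finite M], IsOddFourMultipede M ↔
      ((((AxOne (fun x y : M => Structure.RelMap (L := vocabulary) Symbol.edge ![x, y]) ∧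
      AxHyper (fun x y : M => Structure.RelMap (L := vocabulary) Symbol.edge ![x, y])
        (fun x y z : M => Structure.RelMap (L := vocabulary) Symbol.hyper ![x, y, z]) ∧
      AxTwoMinus (fun x y : M => Structure.RelMap (L := vocabulary) Symbol.edge ![x, y])
        (fun x y z : M => Structure.RelMap (L := vocabulary) Symbol.hyper ![x, y, z])) ∧
      AxTwo (fun x y : M => Structure.RelMap (L := vocabulary) Symbol.edge ![x, y])
        (fun x y z : M => Structure.RelMap (L := vocabulary) Symbol.hyper ![x, y, z])) ∧
      AxThree (fun x y : M => Structure.RelMap (L := vocabulary) Symbol.edge ![x, y])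
        (fun x y : M => Structure.RelMap (L := vocabulary) Symbol.less ![x, y])) ∧
      AxFour (fun x y : M => Structure.RelMap (L := vocabulary) Symbol.edge ![x, y])
        (fun x y : M => Structure.RelMap (L := vocabulary) Symbol.contain ![x, y])) ∧
      AxOdd (fun x y : M => Structure.RelMap (L := vocabulary) Symbol.edge ![x, y])
        (fun x y z : M => Structure.RelMap (L := vocabulary) Symbol.hyper ![x, y, z])
        (fun x y : M => Structure.RelMap (L := vocabulary) Symbol.contain ![x, y]) := by
    intro M _ _
    rw [axFour_iff]
    exact (and_congr_right fun h => h.axOdd_iff).symm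
  refine finitelyAxiomatizable_of_foDefinable ?_ key
  -- Unfolded, the axioms are built from atomic formulas by connectives and quantifiers only, so
  -- definability follows by recursion on their syntax.
  simp only [AxOne, AxHyper, AxTwoMinus, AxTwo, AxThree, AxFour, AxOdd, PosSlave, SegmentsEq,
    SameTriple, SlaveEquivTriple, SwapEq]
  repeat' first
    | exact FODefinable.eq _ _
    | exact FODefinable.rel₂ _ _ _
    | exact FODefinable.rel₃ _ _ _ _
    | apply FODefinable.and
    | apply FODefinable.not
    | apply FODefinable.or
    | apply FODefinable.iff
    | apply FODefinable.ex
    | apply FODefinable.imp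
    | apply FODefinable.all

end Multipede

/-! ## The multipede of a hypergraph -/

namespace Multipede

/-- The elements of the 4-multipede with segments `V`. -/
inductive Elem (V : Type) : Type w
  | foot (s : V) (i : ZMod 2)
  | seg (s : V)
  | super (X : Set V)

namespace Elem

variable {V : Type}

instance [Finite V] : Finite (Elem.{w} V) := by
  refine Finite.of_surjective
    (fun x : (V × ZMod 2) ⊕ V ⊕ Set V => show Elem.{w} V from match x with
      | .inl p => foot p.1 p.2
      | .inr (.inl s) => seg s
      | .inr (.inr X) => super X) ?_
  rintro (⟨s, i⟩ | s | X)
  · exact ⟨.inl (s, i), rfl⟩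
  · exact ⟨.inr (.inl s), rfl⟩
  · exact ⟨.inr (.inr X), rfl⟩

def edge : Elem.{w} V → Elem.{w} V → Prop
  | foot s _, seg s' => s = s'
  | _, _ => False

/-- The positive slaves are those with label sum zero: four of the eight, any two differing at zero
or two segments. -/
def hyper (H : V → V → V → Prop) : Elem.{w} V → Elem.{w} V → Elem.{w} V → Prop
  | seg p, seg q, seg r => H p q r
  | foot p i, foot q j, foot r k => H p q r ∧ i + j + k = 0
  | _, _, _ => False

/-- Any linear order of the segments would serve. -/
def less : Elem.{w} V → Elem.{w} V → Prop
  | seg p, seg q => WellOrderingRel p q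
  | _, _ => False

def contain : Elem.{w} V → Elem.{w} V → Prop
  | seg p, super X => p ∈ X
  | _, _ => False

/-- The multipede of the hypergraph `H`. -/
@[reducible]
def multipede (H : V → V → V → Prop) : vocabulary.Structure (Elem.{w} V) where
  funMap := fun f => nomatch f
  RelMap := fun {n} R => match n, R with
    | _, Symbol.edge => fun v => edge (v 0) (v 1)
    | _, Symbol.hyper => fun v => hyper H (v 0) (v 1) (v 2)
    | _, Symbol.less => fun v => less (v 0) (v 1)
    | _, Symbol.contain => fun v => contain (v 0) (v 1)

theorem edge_iff {x y : Elem.{w} V} : edge x y ↔ ∃ s i, x = foot s i ∧ y = seg s := by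
  cases x <;> cases y <;> simp [edge]
  exact eq_comm

theorem mem_feet {x : Elem.{w} V} : x ∈ feet edge ↔ ∃ s i, x = foot s i := by
  simp [feet, edge_iff]

theorem mem_segments {x : Elem.{w} V} : x ∈ segments edge ↔ ∃ s, x = seg s := by
  simp [segments, edge_iff]

theorem edge_foot {s : V} {i : ZMod 2} {y : Elem.{w} V} : edge (foot s i) y ↔ y = seg s := by
  cases y <;> simp [edge]
  exact eq_comm

theorem edge_seg {s : V} {x : Elem.{w} V} : edge x (seg s) ↔ ∃ i, x = foot s i := by
  cases x <;> simp [edge]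

theorem super_iff {x : Elem.{w} V} : x ∉ feet edge ∪ segments edge ↔ ∃ X, x = super X := by
  cases x <;> simp [mem_feet, mem_segments]

theorem hyper_iff {H : V → V → V → Prop} {x y z : Elem.{w} V} : hyper H x y z ↔
    (∃ p q r, H p q r ∧ x = seg p ∧ y = seg q ∧ z = seg r) ∨
    ∃ p q r i j k, H p q r ∧ i + j + k = 0 ∧ x = foot p i ∧ y = foot q j ∧ z = foot r k := by
  cases x <;> cases y <;> cases z <;> simp [hyper]

theorem segmentsOf_foot (p q r : V) (i j k : ZMod 2) :
    segmentsOf edge ({foot p i, foot q j, foot r k} : Set (Elem.{w} V)) = {seg p, seg q, seg r} := by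
  ext y
  simp [segmentsOf, edge_foot]

theorem isOneMultipede : IsOneMultipede (feet edge ∪ segments edge) (edge (V := V)) where
  disjoint := by
    ext x
    cases x <;> simp [mem_feet, mem_segments]
  cover := rfl
  foot := by
    intro x hx
    obtain ⟨s, i, rfl⟩ := mem_feet.1 hx
    exact ⟨seg s, edge_foot.2 rfl, fun y => edge_foot.1⟩
  segment := by
    intro x hx
    obtain ⟨s, rfl⟩ := mem_segments.1 hx
    refine Set.ncard_eq_two.2 ⟨foot s 0, foot s 1, by simp, ?_⟩
    ext x
    simp only [Set.mem_ofPred_eq, edge_seg, Set.mem_insert_iff, Set.mem_singleton_iff]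
    constructor
    · rintro ⟨i, rfl⟩
      fin_cases i
      · exact Or.inl rfl
      · exact Or.inr rfl
    · rintro (rfl | rfl)
      · exact ⟨0, rfl⟩
      · exact ⟨1, rfl⟩

/-- `H` is a 3-uniform hypergraph on all of `V`. -/
structure IsTripleSystem (H : V → V → V → Prop) : Prop where
  ne : ∀ p q r, H p q r → p ≠ q ∧ q ≠ r ∧ p ≠ r
  symm : ∀ p q r, H p q r → H q p r ∧ H p r q

variable {H : V → V → V → Prop}

theorem isTwoMinusMultipede [Nonempty V] (hH : IsTripleSystem H) :
    IsTwoMinusMultipede (feet edge ∪ segments edge) (edge (V := V)) (hyper H) where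
  oneMultipede := isOneMultipede
  hypergraph :=
    { nonempty := ⟨seg (Classical.arbitrary V), Or.inr (mem_segments.2 ⟨_, rfl⟩)⟩
      mem := by
        intro x y z h
        rcases hyper_iff.1 h with ⟨p, q, r, _, rfl, rfl, rfl⟩ |
          ⟨p, q, r, i, j, k, _, _, rfl, rfl, rfl⟩ <;>
        simp [mem_feet, mem_segments]
      ne := by
        intro x y z h
        rcases hyper_iff.1 h with ⟨p, q, r, h', rfl, rfl, rfl⟩ |
          ⟨p, q, r, i, j, k, h', _, rfl, rfl, rfl⟩ <;>
        have := hH.ne _ _ _ h' <;> simp [this.1, this.2.1, this.2.2]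
      symm := by
        intro x y z h
        rcases hyper_iff.1 h with ⟨p, q, r, h', rfl, rfl, rfl⟩ |
          ⟨p, q, r, i, j, k, h', h0, rfl, rfl, rfl⟩
        · exact hH.symm _ _ _ h'
        · have := hH.symm _ _ _ h'
          exact ⟨⟨this.1, by rw [← h0]; ring⟩, ⟨this.2, by rw [← h0]; ring⟩⟩ }
  uniform := by
    rintro _ ⟨x, y, z, h, rfl⟩
    rw [triple_subset, triple_subset]
    rcases hyper_iff.1 h with ⟨p, q, r, h', rfl, rfl, rfl⟩ |
          ⟨p, q, r, i, j, k, h', _, rfl, rfl, rfl⟩ <;>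
    simp [mem_feet, mem_segments]
  project := by
    rintro _ ⟨x, y, z, h, rfl⟩ hf
    rw [triple_subset] at hf
    rcases hyper_iff.1 h with ⟨p, q, r, h', rfl, rfl, rfl⟩ |
          ⟨p, q, r, i, j, k, h', _, rfl, rfl, rfl⟩
    · simp [mem_feet] at hf
    · rw [segmentsOf_foot]
      exact ⟨_, _, _, show hyper H (seg p) (seg q) (seg r) from h', rfl⟩

theorem mem_positiveSlaves [Nonempty V] (hH : IsTripleSystem H) {p q r : V} (h : H p q r)
    {A : Set (Elem.{w} V)} : A ∈ positiveSlaves edge (hyper H) {seg p, seg q, seg r} ↔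
      ∃ i j k, i + j + k = 0 ∧ A = {foot p i, foot q j, foot r k} := by
  have hM := (isTwoMinusMultipede.{w} hH).hypergraph
  obtain ⟨hpq, hqr, hpr⟩ := hH.ne _ _ _ h
  constructor
  · rintro ⟨⟨hf, h3, hs⟩, hA⟩
    have hfoot : ∀ s, (seg s : Elem.{w} V) ∈ ({seg p, seg q, seg r} : Set (Elem.{w} V)) →
        ∃ i, foot s i ∈ A := by
      intro s hs'
      rw [← hs] at hs'
      obtain ⟨x, hx, hxs⟩ := hs'
      obtain ⟨i, rfl⟩ := edge_seg.1 hxs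
      exact ⟨i, hx⟩
    obtain ⟨i, hi⟩ := hfoot p (by simp)
    obtain ⟨j, hj⟩ := hfoot q (by simp)
    obtain ⟨k, hk⟩ := hfoot r (by simp)
    have heq : ({foot p i, foot q j, foot r k} : Set (Elem.{w} V)) = A := by
      refine Set.eq_of_subset_of_ncard_le ((triple_subset _ _ _ _).2 ⟨hi, hj, hk⟩) ?_
        (Set.finite_of_ncard_ne_zero (by omega))
      rw [h3, ncard_triple (by simp [hpq]) (by simp [hqr]) (by simp [hpr])]
    subst heq
    exact ⟨i, j, k, (hM.mem_hyperedges.1 hA).2, rfl⟩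
  · rintro ⟨i, j, k, h0, rfl⟩
    refine ⟨⟨?_, ?_, segmentsOf_foot _ _ _ _ _ _⟩, hM.mem_hyperedges.2 ⟨h, h0⟩⟩
    · simp [triple_subset, mem_feet]
    · exact ncard_triple (by simp [hpq]) (by simp [hqr]) (by simp [hpr])

open Classical in
theorem swap_foot {s t : V} {i : ZMod 2} :
    Equiv.swap (foot s 0 : Elem.{w} V) (foot s 1) (foot t i) =
      if t = s then foot t (i + 1) else foot t i := by
  by_cases h : t = s
  · subst h
    rw [if_pos rfl]
    fin_cases i
    · exact Equiv.swap_apply_left _ _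
    · exact Equiv.swap_apply_right _ _
  · rw [if_neg h, Equiv.swap_apply_of_ne_of_ne] <;> simp [h]

/-- The difference of the two label triples has sum zero, so it is zero or has exactly two ones;
these mark the segments to be exchanged. -/
theorem slaveEquiv {p q r : V} (hpq : p ≠ q) (hqr : q ≠ r) (hpr : p ≠ r) {i j k i' j' k' : ZMod 2}
    (h : i + j + k = 0) (h' : i' + j' + k' = 0) :
    SlaveEquiv edge ({seg p, seg q, seg r} : Set (Elem.{w} V)) {foot p i, foot q j, foot r k}
      {foot p i', foot q j', foot r k'} := by
  classical
  have hcases : (i' = i ∧ j' = j ∧ k' = k) ∨ (i' = i + 1 ∧ j' = j + 1 ∧ k' = k) ∨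
      (i' = i + 1 ∧ j' = j ∧ k' = k + 1) ∨ (i' = i ∧ j' = j + 1 ∧ k' = k + 1) := by
    revert i j k i' j' k'; decide
  have hsw : ∀ s ∈ ({seg p, seg q, seg r} : Set (Elem.{w} V)),
      ∀ t ∈ ({seg p, seg q, seg r} : Set (Elem.{w} V)), s ≠ t → ∀ p' q', s = seg p' → t = seg q' →
      ∀ A B : Set (Elem.{w} V), B = (fun c => Equiv.swap (foot p' 0) (foot p' 1)
        (Equiv.swap (foot q' 0) (foot q' 1) c)) '' A →
      SlaveEquiv edge ({seg p, seg q, seg r} : Set (Elem.{w} V)) A B := by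
    rintro s hs t ht hst p' q' rfl rfl A B h
    exact Or.inr ⟨_, hs, _, ht, hst, _, _, _, _, by simp, edge_foot.2 rfl, edge_foot.2 rfl, by simp,
      edge_foot.2 rfl, edge_foot.2 rfl, h⟩
  rcases hcases with ⟨rfl, rfl, rfl⟩ | ⟨rfl, rfl, rfl⟩ | ⟨rfl, rfl, rfl⟩ | ⟨rfl, rfl, rfl⟩
  · exact Or.inl rfl
  · refine hsw (seg p) (by simp) (seg q) (by simp) (by simp [hpq]) p q rfl rfl _ _ ?_
    simp [Set.image_insert_eq, swap_foot, hpq, hpq.symm, hqr.symm, hpr.symm]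
  · refine hsw (seg p) (by simp) (seg r) (by simp) (by simp [hpr]) p r rfl rfl _ _ ?_
    simp [Set.image_insert_eq, swap_foot, hpq.symm, hqr, hpr, hpr.symm]
  · refine hsw (seg q) (by simp) (seg r) (by simp) (by simp [hqr]) q r rfl rfl _ _ ?_
    simp [Set.image_insert_eq, swap_foot, hpq, hqr, hqr.symm, hpr]

theorem isTwoMultipede [Nonempty V] (hH : IsTripleSystem H) :
    IsTwoMultipede (feet edge ∪ segments edge) (edge (V := V)) (hyper H) := by
  have hX : ∀ X ∈ hyperedges (hyper (V := V) H), X ⊆ segments edge →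
      ∃ p q r, H p q r ∧ X = {seg p, seg q, seg r} := by
    rintro _ ⟨x, y, z, h, rfl⟩ hs
    rw [triple_subset] at hs
    rcases hyper_iff.1 h with ⟨p, q, r, h', rfl, rfl, rfl⟩ |
          ⟨p, q, r, i, j, k, h', _, rfl, rfl, rfl⟩
    · exact ⟨p, q, r, h', rfl⟩
    · simp [mem_segments] at hs
  refine ⟨isTwoMinusMultipede hH, ?_, ?_⟩
  · intro X hX1 hX2
    obtain ⟨p, q, r, h, rfl⟩ := hX X hX1 hX2
    obtain ⟨hpq, hqr, hpr⟩ := hH.ne _ _ _ h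
    have : positiveSlaves edge (hyper H) ({seg p, seg q, seg r} : Set (Elem V)) =
        Set.range fun c : ZMod 2 × ZMod 2 => {foot p c.1, foot q c.2, foot r (c.1 + c.2)} := by
      ext A
      rw [mem_positiveSlaves hH h]
      constructor
      · rintro ⟨i, j, k, h0, rfl⟩
        refine ⟨(i, j), ?_⟩
        have : k = i + j := by revert i j k; decide
        rw [this]
      · rintro ⟨⟨i, j⟩, rfl⟩
        exact ⟨i, j, i + j, CharTwo.add_self_eq_zero _, rfl⟩
    rw [this, ← Set.image_univ, Set.ncard_image_of_injective, Set.ncard_univ]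
    · simp
    · rintro ⟨i, j⟩ ⟨i', j'⟩ he
      have he' : ({foot p i, foot q j, foot r (i + j)} : Set (Elem V)) =
        {foot p i', foot q j', foot r (i' + j')} := he
      have h1 : (foot p i : Elem V) ∈ ({foot p i', foot q j', foot r (i' + j')} : Set (Elem V)) := by
        rw [← he']; simp
      have h2 : (foot q j : Elem V) ∈ ({foot p i', foot q j', foot r (i' + j')} : Set (Elem V)) := by
        rw [← he']; simp
      simp [hpq, hpr] at h1
      simp [hpq.symm, hqr] at h2
      rw [h1, h2]
  · intro X hX1 hX2 A hA B hB
    obtain ⟨p, q, r, h, rfl⟩ := hX X hX1 hX2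
    obtain ⟨hpq, hqr, hpr⟩ := hH.ne _ _ _ h
    obtain ⟨i, j, k, h0, rfl⟩ := (mem_positiveSlaves hH h).1 hA
    obtain ⟨i', j', k', h0', rfl⟩ := (mem_positiveSlaves hH h).1 hB
    exact slaveEquiv hpq hqr hpr h0 h0'

theorem isFourMultipede [Nonempty V] (hH : IsTripleSystem H) :
    IsFourMultipede (edge (V := V)) (hyper H) less contain where
  threeMultipede :=
    { twoMultipede := isTwoMultipede hH
      lt_mem := by
        intro x y h
        cases x <;> cases y <;> simp_all [less, mem_segments]
      lt_irrefl := by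
        intro x h
        cases x
        · exact h
        · exact irrefl_of WellOrderingRel _ h
        · exact h
      lt_trans := by
        intro x y z h h'
        cases x <;> cases y <;> cases z <;> simp only [less] at h h' ⊢
        exact trans_of WellOrderingRel h h'
      lt_total := by
        intro x hx y hy
        obtain ⟨p, rfl⟩ := mem_segments.1 hx
        obtain ⟨q, rfl⟩ := mem_segments.1 hy
        rcases trichotomous_of WellOrderingRel p q with h | h | h
        · exact Or.inr (Or.inl h)
        · exact Or.inl (h ▸ rfl)
        · exact Or.inr (Or.inr h) }
  eps_mem := by
    intro x Y h
    cases x <;> cases Y <;> simp_all [contain, mem_segments, mem_feet]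
  represent := by
    intro X hX
    refine ⟨super {s | seg s ∈ X}, ⟨super_iff.2 ⟨_, rfl⟩, fun x => ?_⟩, ?_⟩
    · cases x with
      | seg s => exact Iff.rfl
      | foot s i =>
        refine ⟨fun h => h.elim, fun h => ?_⟩
        obtain ⟨_, h⟩ := mem_segments.1 (hX h)
        cases h
      | super Y =>
        refine ⟨fun h => h.elim, fun h => ?_⟩
        obtain ⟨_, h⟩ := mem_segments.1 (hX h)
        cases h
    · rintro Y ⟨hY, he⟩
      obtain ⟨Y, rfl⟩ := super_iff.1 hY
      congr 1
      ext s
      exact he (seg s)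

/-- The indicator function of a set that meets every hyperedge evenly solves the linear system. -/
theorem isOddFourMultipede [Nonempty V] (hH : IsTripleSystem H)
    (hodd : ∀ f : V → ZMod 2, (∀ p q r, H p q r → f p + f q + f r = 0) → f = 0) :
    letI := multipede.{w} H
    IsOddFourMultipede (Elem.{w} V) := by
  refine ⟨isFourMultipede hH, ?_⟩
  change IsOdd (segments edge) (hyper H)
  classical
  intro X hX hne
  by_contra! hcon
  have h0 := hodd (fun s => if (seg s : Elem.{w} V) ∈ X then 1 else 0) ?_
  · obtain ⟨x, hx⟩ := hne
    obtain ⟨s, rfl⟩ := mem_segments.1 (hX hx)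
    have := congrFun h0 s
    simp [hx] at this
  · intro p q r h
    have hh := hcon {seg p, seg q, seg r}
      ⟨_, _, _, show hyper H (seg p) (seg q) (seg r) from h, rfl⟩
      (by simp [triple_subset, mem_segments])
    obtain ⟨hpq, hqr, hpr⟩ := hH.ne _ _ _ h
    rw [odd_ncard_inter (by simp [hpq]) (by simp [hqr]) (by simp [hpr])] at hh
    by_cases h1 : (seg p : Elem.{w} V) ∈ X <;> by_cases h2 : (seg q : Elem.{w} V) ∈ X <;>
      by_cases h3 : (seg r : Elem.{w} V) ∈ X <;> simp [h1, h2, h3] at hh ⊢ <;> rfl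

end Elem

end Multipede

/-! ## Formulas do not distinguish consistent twists -/

theorem exists_eq_var (t : Multipede.vocabulary.Term ℕ) : ∃ n, t = FirstOrder.Language.Term.var n := by
  cases t with
  | var n => exact ⟨n, rfl⟩
  | func f => exact nomatch f

/-- The variables that occur in a fixed-point formula. -/
def FPFormula.allVars {L : FirstOrder.Language.{0, 0}} : FPFormula L → Finset ℕ
  | equal t₁ t₂ => t₁.varFinset ∪ t₂.varFinset
  | rel _ ts => Finset.univ.biUnion fun i => (ts i).varFinset
  | relVar _ _ ts => Finset.univ.biUnion fun i => (ts i).varFinset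
  | neg φ => φ.allVars
  | and φ ψ => φ.allVars ∪ ψ.allVars
  | or φ ψ => φ.allVars ∪ ψ.allVars
  | ex x φ => {x} ∪ φ.allVars
  | all x φ => {x} ∪ φ.allVars
  | fix _ _ x φ ts => Finset.univ.image x ∪ φ.allVars ∪ Finset.univ.biUnion fun i => (ts i).varFinset

/-- The nesting depth of fixed points. -/
def FPFormula.fixDepth {L : FirstOrder.Language.{0, 0}} : FPFormula L → ℕ
  | equal _ _ => 0
  | rel _ _ => 0
  | relVar _ _ _ => 0
  | neg φ => φ.fixDepth
  | and φ ψ => max φ.fixDepth ψ.fixDepth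
  | or φ ψ => max φ.fixDepth ψ.fixDepth
  | ex _ φ => φ.fixDepth
  | all _ φ => φ.fixDepth
  | fix _ _ _ φ _ => φ.fixDepth + 1

namespace Multipede

namespace Elem

variable {V : Type}

/-- Exchange the feet of the segments `s` with `t s = 1`. -/
def twist (t : V → ZMod 2) : Elem.{w} V → Elem.{w} V
  | foot s i => foot s (i + t s)
  | x => x

theorem twist_involutive (t : V → ZMod 2) : Function.Involutive (twist.{w} t) := by
  intro x
  cases x <;> simp [twist, add_assoc, CharTwo.add_self_eq_zero]

/-- The set containing the segment of a foot. -/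
def base : Elem.{w} V → Finset V
  | foot s _ => {s}
  | _ => ∅

theorem card_base_le (x : Elem.{w} V) : x.base.card ≤ 1 := by
  cases x <;> simp [base]

theorem twist_congr {t t' : V → ZMod 2} {x : Elem.{w} V} (h : ∀ s ∈ x.base, t s = t' s) :
    twist t x = twist t' x := by
  cases x <;> simp_all [twist, base]

theorem twist_injective (t : V → ZMod 2) : Function.Injective (twist.{w} t) :=
  (twist_involutive t).injective

/-- Only the foot hyperedges depend on the labels, and a twist changes the label sum by `t p + t q +
t r`. -/
theorem relMap_twist {H : V → V → V → Prop} {t : V → ZMod 2} {P : Finset V}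
    (hH : ∀ p q r, H p q r → p ∈ P → q ∈ P → r ∈ P → t p + t q + t r = 0) {n : ℕ}
    (R : vocabulary.Relations n) (v : Fin n → Elem.{w} V) (hv : ∀ i, (v i).base ⊆ P) :
    letI := multipede.{w} H
    (FirstOrder.Language.Structure.RelMap R (fun i => twist t (v i)) ↔
      FirstOrder.Language.Structure.RelMap R v) := by
  cases R with
  | edge =>
    change edge (twist t (v 0)) (twist t (v 1)) ↔ edge (v 0) (v 1)
    cases v 0 <;> cases v 1 <;> rfl
  | hyper =>
    change hyper H (twist t (v 0)) (twist t (v 1)) (twist t (v 2)) ↔ hyper H (v 0) (v 1) (v 2)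
    have h0 := hv 0
    have h1 := hv 1
    have h2 := hv 2
    generalize v 0 = x at *
    generalize v 1 = y at *
    generalize v 2 = z at *
    cases x <;> cases y <;> cases z <;> try rfl
    simp only [base, Finset.singleton_subset_iff] at h0 h1 h2
    refine and_congr_right fun h => ?_
    refine iff_of_eq (congrArg (· = 0) ?_)
    linear_combination hH _ _ _ h h0 h1 h2
  | less =>
    change less (twist t (v 0)) (twist t (v 1)) ↔ less (v 0) (v 1)
    cases v 0 <;> cases v 1 <;> rfl
  | contain =>
    change contain (twist t (v 0)) (twist t (v 1)) ↔ contain (v 0) (v 1)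
    cases v 0 <;> cases v 1 <;> rfl

variable [DecidableEq V]

/-- The segments of the feet among the values of the variables in `W`. -/
def bases (W : Finset ℕ) (v : ℕ → Elem.{w} V) : Finset V := W.biUnion fun n => (v n).base

theorem base_subset_bases {W : Finset ℕ} {v : ℕ → Elem.{w} V} {n : ℕ} (hn : n ∈ W) :
    (v n).base ⊆ bases W v :=
  Finset.subset_biUnion_of_mem (fun n => (v n).base) hn

theorem card_bases_le (W : Finset ℕ) (v : ℕ → Elem.{w} V) : (bases W v).card ≤ W.card := by
  simpa [bases] using Finset.card_biUnion_le_card_mul W (fun n => (v n).base) 1 fun n _ => card_base_le _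

theorem realize_term {H : V → V → V → Prop} {W : Finset ℕ} {t : V → ZMod 2}
    {v v' : ℕ → Elem.{w} V} (h : ∀ n ∈ W, v' n = twist t (v n)) (τ : vocabulary.Term ℕ)
    (hτ : τ.varFinset ⊆ W) :
    letI := multipede.{w} H
    τ.realize v' = twist t (τ.realize v) ∧ (τ.realize v).base ⊆ bases W v := by
  obtain ⟨n, rfl⟩ := exists_eq_var τ
  have hn : n ∈ W := hτ (by simp [FirstOrder.Language.Term.varFinset])
  exact ⟨h n hn, base_subset_bases hn⟩

variable [Fintype V]

/-- On the variables in `W`, the assignment `v'` is the twist of `v` by `t`, and `t` is consistent on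
the segments involved and on the further segments in `P`. -/
structure Matches (d : (V → ZMod 2) → V → ZMod 2) (K : ℕ) (P : Finset V) (W : Finset ℕ)
    (t : V → ZMod 2) (v v' : ℕ → Elem.{w} V) : Prop where
  consistent : Consistent d K t (P ∪ bases W v)
  twist_eq : ∀ n ∈ W, v' n = twist t (v n)

variable {d : (V → ZMod 2) → V → ZMod 2} {K : ℕ} {P : Finset V} {W : Finset ℕ} {t : V → ZMod 2}
  {v v' : ℕ → Elem.{w} V}

/-- One round of the bijective pebble game: the pebble `x` is lifted and a bijection is offered that
answers all its new positions at once. A bijection rather than a separate answer for each element is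
what handles counting. -/
theorem Matches.exists_equiv (hd : Expands d K) (h : Matches d K P W t v v')
    (hcard : P.card + W.card ≤ K) {x : ℕ} (hx : x ∈ W) :
    ∃ σ : Elem.{w} V ≃ Elem.{w} V, ∀ a, ∃ t', (∀ s ∈ P, t' s = t s) ∧
      Matches d K P W t' (Function.update v x a) (Function.update v' x (σ a)) := by
  let Q := P ∪ bases (W.erase x) v
  have hQ : Q ⊆ P ∪ bases W v :=
    Finset.union_subset_union_right (Finset.biUnion_subset_biUnion_of_subset_left _ (W.erase_subset x))
  have hQc : Q.card ≤ K := by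
    refine (Finset.card_union_le _ _).trans ?_
    have := card_bases_le (W.erase x) v
    have := Finset.card_erase_le (s := W) (a := x)
    omega
  -- The values of `b` are chosen for each segment separately, and `b` as a whole need not be
  -- consistent; each answer involves at most one new segment.
  choose b hb hbc using fun s => (h.consistent.mono hQ).extend hd hQc s
  refine ⟨(twist_involutive b).toPerm, fun a => ?_⟩
  have hmain : ∀ t' : V → ZMod 2, (∀ s ∈ Q, t' s = t s) → (∀ s ∈ a.base, t' s = b s) →
      Consistent d K t' (Q ∪ a.base) → (∀ s ∈ P, t' s = t s) ∧
      Matches d K P W t' (Function.update v x a) (Function.update v' x (twist b a)) := by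
    intro t' h1 h2 h3
    refine ⟨fun s hs => h1 s (Finset.mem_union_left _ hs), h3.mono ?_, fun n hn => ?_⟩
    · refine Finset.union_subset (Finset.subset_union_left.trans Finset.subset_union_left) ?_
      refine Finset.biUnion_subset.2 fun n hn => ?_
      by_cases hnx : n = x
      · subst hnx
        rw [Function.update_self]
        exact Finset.subset_union_right
      · rw [Function.update_of_ne hnx]
        exact ((base_subset_bases (Finset.mem_erase.2 ⟨hnx, hn⟩)).trans
          Finset.subset_union_right).trans Finset.subset_union_left
    · by_cases hnx : n = x
      · subst hnx
        rw [Function.update_self, Function.update_self]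
        exact twist_congr fun s hs => (h2 s hs).symm
      · rw [Function.update_of_ne hnx, Function.update_of_ne hnx, h.twist_eq n hn]
        refine twist_congr fun s hs => (h1 s (Finset.mem_union_right _ ?_)).symm
        exact base_subset_bases (Finset.mem_erase.2 ⟨hnx, hn⟩) hs
  cases a with
  | foot s i =>
    refine ⟨Function.update t s (b s), hmain _ ?_ ?_ ?_⟩
    · intro r hr
      by_cases hrs : r = s
      · subst hrs; rw [Function.update_self, hb r hr]
      · rw [Function.update_of_ne hrs]
    · simp [base]
    · rw [base, Finset.union_comm, ← Finset.insert_eq]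
      exact hbc s
  | seg s =>
    exact ⟨t, hmain t (fun _ _ => rfl) (by simp [base])
      (by simpa [base] using h.consistent.mono hQ)⟩
  | super X =>
    exact ⟨t, hmain t (fun _ _ => rfl) (by simp [base])
      (by simpa [base] using h.consistent.mono hQ)⟩

/-- The consistency conditions include those of the hyperedges of `H`. -/
def Covers (d : (V → ZMod 2) → V → ZMod 2) (K : ℕ) (H : V → V → V → Prop) : Prop :=
  ∀ (t : V → ZMod 2) (P : Finset V), Consistent d K t P →
    ∀ p q r, H p q r → p ∈ P → q ∈ P → r ∈ P → t p + t q + t r = 0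

variable {H : V → V → V → Prop}

theorem Matches.relMap_iff (hc : Covers d K H) (h : Matches d K P W t v v') {n : ℕ}
    (R : vocabulary.Relations n) (ts : Fin n → vocabulary.Term ℕ) (hts : ∀ i, (ts i).varFinset ⊆ W) :
    letI := multipede.{w} H
    (FirstOrder.Language.Structure.RelMap R (fun i => (ts i).realize v) ↔
      FirstOrder.Language.Structure.RelMap R fun i => (ts i).realize v') := by
  let _ := multipede.{w} H
  have := fun i => realize_term (H := H) h.twist_eq (ts i) (hts i)
  simp only [(this _).1]
  exact (relMap_twist (hc t _ h.consistent) R _ fun i =>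
    (this i).2.trans Finset.subset_union_right).symm

theorem Matches.equal_iff (h : Matches d K P W t v v') (t₁ t₂ : vocabulary.Term ℕ)
    (h₁ : t₁.varFinset ⊆ W) (h₂ : t₂.varFinset ⊆ W) :
    letI := multipede.{w} H
    (t₁.realize v = t₂.realize v ↔ t₁.realize v' = t₂.realize v') := by
  let _ := multipede.{w} H
  rw [(realize_term (H := H) h.twist_eq t₁ h₁).1, (realize_term (H := H) h.twist_eq t₂ h₂).1,
    (twist_injective t).eq_iff]

/-- Atomic formulas are preserved because a consistent twist respects the hyperedges on the segments
in play; quantifiers are answered by the bijections of `Matches.exists_equiv`. -/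
theorem realize_infFormula_iff (hd : Expands d K) (hc : Covers d K H) (hW : W.card ≤ K)
    (φ : InfFormula.{u} vocabulary) (hφ : φ.vars ⊆ W) :
    letI := multipede.{w} H
    ∀ t v v', Matches d K ∅ W t v v' → (φ.Realize v ↔ φ.Realize v') := by
  let _ := multipede.{w} H
  have hK : (∅ : Finset V).card + W.card ≤ K := by simpa using hW
  induction φ with
  | equal t₁ t₂ =>
    intro t v v' h
    simp only [InfFormula.vars, Set.union_subset_iff, Finset.coe_subset] at hφ
    exact h.equal_iff t₁ t₂ hφ.1 hφ.2
  | rel R ts =>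
    intro t v v' h
    simp only [InfFormula.vars, Set.iUnion_subset_iff, Finset.coe_subset] at hφ
    exact h.relMap_iff hc R ts hφ
  | neg φ ih => exact fun t v v' h => not_congr (ih hφ t v v' h)
  | conj φ ih =>
    simp only [InfFormula.vars, Set.iUnion_subset_iff] at hφ
    exact fun t v v' h => forall_congr' fun i => ih i (hφ i) t v v' h
  | disj φ ih =>
    simp only [InfFormula.vars, Set.iUnion_subset_iff] at hφ
    exact fun t v v' h => exists_congr fun i => ih i (hφ i) t v v' h
  | ex x φ ih =>
    simp only [InfFormula.vars, Set.union_subset_iff, Set.singleton_subset_iff] at hφ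
    intro t v v' h
    obtain ⟨σ, hσ⟩ := h.exists_equiv hd hK (Finset.mem_coe.1 hφ.1)
    refine σ.exists_congr fun a => ?_
    obtain ⟨t', -, h'⟩ := hσ a
    exact ih hφ.2 t' _ _ h'
  | all x φ ih =>
    simp only [InfFormula.vars, Set.union_subset_iff, Set.singleton_subset_iff] at hφ
    intro t v v' h
    obtain ⟨σ, hσ⟩ := h.exists_equiv hd hK (Finset.mem_coe.1 hφ.1)
    refine σ.forall_congr fun {a} => ?_
    obtain ⟨t', -, h'⟩ := hσ a
    exact ih hφ.2 t' _ _ h'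
  | exCount m x φ ih =>
    simp only [InfFormula.vars, Set.union_subset_iff, Set.singleton_subset_iff] at hφ
    intro t v v' h
    obtain ⟨σ, hσ⟩ := h.exists_equiv hd hK (Finset.mem_coe.1 hφ.1)
    -- The bijection carries witness sets to witness sets of the same size.
    refine (Equiv.finsetCongr σ).exists_congr fun s => ?_
    refine and_congr (by simp) ?_
    simp only [Equiv.finsetCongr_apply, Finset.forall_mem_map]
    refine forall₂_congr fun a _ => ?_
    obtain ⟨t', -, h'⟩ := hσ a
    exact ih hφ.2 t' _ _ h'

/-- The relation assignments `ρ` and `ρ'` agree up to consistent twists that extend the twist `t` of the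
segments in `P`. -/
def RelMatches (d : (V → ZMod 2) → V → ZMod 2) (K : ℕ) (P : Finset V) (t : V → ZMod 2)
    (ρ ρ' : (r : ℕ) → ℕ → (Fin r → Elem.{w} V) → Prop) : Prop :=
  ∀ r i t', (∀ s ∈ P, t' s = t s) → ∀ a : Fin r → Elem.{w} V,
    Consistent d K t' (P ∪ Finset.univ.biUnion fun j => (a j).base) →
      (ρ r i a ↔ ρ' r i fun j => twist t' (a j))

/-- The stages of a fixed point depend on its parameters, even where their variables are later
requantified. So on entering a fixed point the segments of all current values are frozen in `P`.
Each nesting level costs at most `W.card` segments, and one further `W.card` is for the current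
values. -/
theorem realize_fpFormula_iff (hd : Expands d K) (hc : Covers d K H)
    (φ : FPFormula vocabulary) (hφ : φ.allVars ⊆ W) :
    letI := multipede.{w} H
    ∀ P t v v' ρ ρ', P.card + (φ.fixDepth + 1) * W.card ≤ K → Matches d K P W t v v' →
      RelMatches d K P t ρ ρ' → (φ.Realize ρ v ↔ φ.Realize ρ' v') := by
  let _ := multipede.{w} H
  induction φ with
  | equal t₁ t₂ =>
    intro P t v v' ρ ρ' _ h _
    simp only [FPFormula.allVars, Finset.union_subset_iff] at hφ
    exact h.equal_iff t₁ t₂ hφ.1 hφ.2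
  | rel R ts =>
    intro P t v v' ρ ρ' _ h _
    simp only [FPFormula.allVars, Finset.biUnion_subset, Finset.mem_univ, true_imp_iff] at hφ
    exact h.relMap_iff hc R ts hφ
  | relVar r i ts =>
    intro P t v v' ρ ρ' _ h hρ
    simp only [FPFormula.allVars, Finset.biUnion_subset, Finset.mem_univ, true_imp_iff] at hφ
    have hr := fun j => realize_term (H := H) h.twist_eq (ts j) (hφ j)
    simp only [FPFormula.Realize, (hr _).1]
    refine hρ r i t (fun _ _ => rfl) _ (h.consistent.mono ?_)
    exact Finset.union_subset_union_right (Finset.biUnion_subset.2 fun j _ => (hr j).2)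
  | neg φ ih => exact fun P t v v' ρ ρ' hK h hρ => not_congr (ih hφ P t v v' ρ ρ' hK h hρ)
  | and φ ψ ih₁ ih₂ =>
    simp only [FPFormula.allVars, Finset.union_subset_iff] at hφ
    intro P t v v' ρ ρ' hK h hρ
    rw [FPFormula.fixDepth] at hK
    refine and_congr (ih₁ hφ.1 P t v v' ρ ρ' (le_trans ?_ hK) h hρ)
      (ih₂ hφ.2 P t v v' ρ ρ' (le_trans ?_ hK) h hρ)
    · gcongr; exact le_max_left _ _
    · gcongr; exact le_max_right _ _
  | or φ ψ ih₁ ih₂ =>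
    simp only [FPFormula.allVars, Finset.union_subset_iff] at hφ
    intro P t v v' ρ ρ' hK h hρ
    rw [FPFormula.fixDepth] at hK
    refine or_congr (ih₁ hφ.1 P t v v' ρ ρ' (le_trans ?_ hK) h hρ)
      (ih₂ hφ.2 P t v v' ρ ρ' (le_trans ?_ hK) h hρ)
    · gcongr; exact le_max_left _ _
    · gcongr; exact le_max_right _ _
  | ex x φ ih =>
    simp only [FPFormula.allVars, Finset.union_subset_iff, Finset.singleton_subset_iff] at hφ
    intro P t v v' ρ ρ' hK h hρ
    obtain ⟨σ, hσ⟩ := h.exists_equiv hd (by nlinarith) hφ.1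
    refine σ.exists_congr fun a => ?_
    obtain ⟨t', ht', h'⟩ := hσ a
    exact ih hφ.2 P t' _ _ ρ ρ' hK h' fun r i t'' ht'' =>
      hρ r i t'' fun s hs => (ht'' s hs).trans (ht' s hs)
  | all x φ ih =>
    simp only [FPFormula.allVars, Finset.union_subset_iff, Finset.singleton_subset_iff] at hφ
    intro P t v v' ρ ρ' hK h hρ
    obtain ⟨σ, hσ⟩ := h.exists_equiv hd (by nlinarith) hφ.1
    refine σ.forall_congr fun {a} => ?_
    obtain ⟨t', ht', h'⟩ := hσ a
    exact ih hφ.2 P t' _ _ ρ ρ' hK h' fun r i t'' ht'' =>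
      hρ r i t'' fun s hs => (ht'' s hs).trans (ht' s hs)
  | fix r i x φ ts ih =>
    simp only [FPFormula.allVars, Finset.union_subset_iff, Finset.biUnion_subset, Finset.mem_univ,
      true_imp_iff] at hφ
    obtain ⟨⟨-, hφ⟩, hts⟩ := hφ
    intro P t v v' ρ ρ' hK h hρ
    rw [FPFormula.fixDepth] at hK
    have hcard : (P ∪ bases W v).card + (φ.fixDepth + 1) * W.card ≤ K := by
      have h1 := Finset.card_union_le P (bases W v)
      have h2 := card_bases_le W v
      nlinarith
    simp only [FPFormula.Realize]
    refine exists_congr fun n => ?_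
    have hr := fun j => realize_term (H := H) h.twist_eq (ts j) (hts j)
    simp only [(hr _).1]
    -- Corresponding stages agree for every twist that extends the frozen one. This uniformity in
    -- `t'` is needed because quantifiers in the body may change the twist outside the frozen
    -- segments before the relation variable is reached.
    have key : ∀ n (t' : V → ZMod 2), (∀ s ∈ P ∪ bases W v, t' s = t s) → ∀ a : Fin r → Elem.{w} V,
        Consistent d K t' ((P ∪ bases W v) ∪ Finset.univ.biUnion fun j => (a j).base) →
        ((fun (Q : (Fin r → Elem.{w} V) → Prop) a => Q a ∨
            φ.Realize (Function.update ρ r (Function.update (ρ r) i Q)) (Function.extend x a v))^[n]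
            (fun _ => False) a ↔
          (fun (Q : (Fin r → Elem.{w} V) → Prop) a => Q a ∨
            φ.Realize (Function.update ρ' r (Function.update (ρ' r) i Q)) (Function.extend x a v'))^[n]
            (fun _ => False) fun j => twist t' (a j)) := by
      intro n
      induction n with
      | zero => exact fun _ _ _ _ => Iff.rfl
      | succ n ihn =>
        intro t' ht' a ha
        rw [Function.iterate_succ_apply', Function.iterate_succ_apply']
        refine or_congr (ihn t' ht' a ha) (ih hφ (P ∪ bases W v) t' _ _ _ _ hcard ⟨?_, ?_⟩ ?_)
        · refine ha.mono (Finset.union_subset Finset.subset_union_left ?_)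
          refine Finset.biUnion_subset.2 fun m hm => ?_
          by_cases hmx : ∃ j, x j = m
          · obtain ⟨j, rfl⟩ := hmx
            rw [x.injective.extend_apply]
            exact (Finset.subset_biUnion_of_mem (fun j => (a j).base) (Finset.mem_univ j)).trans
              Finset.subset_union_right
          · rw [Function.extend_apply' _ _ _ hmx]
            exact ((base_subset_bases hm).trans Finset.subset_union_right).trans
              Finset.subset_union_left
        · intro m hm
          by_cases hmx : ∃ j, x j = m
          · obtain ⟨j, rfl⟩ := hmx
            rw [x.injective.extend_apply, x.injective.extend_apply]
          · rw [Function.extend_apply' _ _ _ hmx, Function.extend_apply' _ _ _ hmx, h.twist_eq m hm]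
            exact twist_congr fun s hs =>
              (ht' s (Finset.mem_union_right _ (base_subset_bases hm hs))).symm
        · intro r' i' t'' ht'' b hb
          have ht : ∀ s ∈ P ∪ bases W v, t'' s = t s := fun s hs => (ht'' s hs).trans (ht' s hs)
          have hρ' := hρ r' i' t'' (fun s hs => ht s (Finset.mem_union_left _ hs)) b
            (hb.mono (Finset.union_subset_union_left Finset.subset_union_left))
          by_cases hrr : r' = r
          · subst hrr
            by_cases hii : i' = i
            · subst hii
              simp only [Function.update_self]
              exact ihn t'' ht b hb
            · simpa only [Function.update_self, Function.update_of_ne hii] using hρ'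
          · simpa only [Function.update_of_ne hrr] using hρ'
    refine key n t (fun _ _ => rfl) _ (h.consistent.mono ?_)
    refine Finset.union_subset (le_refl _) (Finset.biUnion_subset.2 fun j _ => ?_)
    exact (hr j).2.trans Finset.subset_union_right

end Elem

/-! ## No formula defines a linear order -/

/-- A linear order of either kind relates two distinct elements in exactly one direction. -/
theorem IsLinearOrderRelation.false_of_symm {M : Type w} {r : M → M → Prop}
    (h : IsLinearOrderRelation r) {a b : M} (hab : a ≠ b) (hr : r a b ↔ r b a) : False := by
  rcases h with h | h
  · rcases trichotomous_of r a b with h1 | h1 | h1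
    · exact irrefl_of r a (trans_of r h1 (hr.1 h1))
    · exact hab h1
    · exact irrefl_of r b (trans_of r h1 (hr.2 h1))
  · rcases total_of r a b with h1 | h1
    · exact hab (antisymm_of r h1 (hr.1 h1))
    · exact hab (antisymm_of r (hr.2 h1) h1)

/-! ### Expansion and consistency for the group hypergraph. -/

section TwoGroup

variable {G : Type} [Group G]

/-- The hyperedges `{a 0 * h, a 1 * h, a 2 * h}`. -/
def groupHyper (a : Fin 3 → G) (p q r : G) : Prop :=
  ∃ (h : G) (π : Equiv.Perm (Fin 3)), p = a (π 0) * h ∧ q = a (π 1) * h ∧ r = a (π 2) * h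

theorem isTripleSystem_groupHyper {a : Fin 3 → G} (ha : Function.Injective a) :
    Elem.IsTripleSystem (groupHyper a) where
  ne := by
    rintro _ _ _ ⟨h, π, rfl, rfl, rfl⟩
    simp [ha.eq_iff]
  symm := by
    rintro _ _ _ ⟨h, π, rfl, rfl, rfl⟩
    refine ⟨⟨h, π * Equiv.swap 0 1, ?_⟩, ⟨h, π * Equiv.swap 1 2, ?_⟩⟩
    · simp [Equiv.Perm.mul_apply, Equiv.swap_apply_of_ne_of_ne]
    · simp [Equiv.Perm.mul_apply, Equiv.swap_apply_of_ne_of_ne]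

variable [DecidableEq G]

theorem boundary_single {a : Fin 3 → G} (ha : ∀ i, a i * a i = 1) (h s : G) :
    boundary a (Pi.single h 1) s = ∑ i, if s = a i * h then 1 else 0 := by
  refine Finset.sum_congr rfl fun i _ => ?_
  simp [Pi.single_apply, mul_eq_iff_of_involution ha]

variable [Fintype G]

theorem expands_boundary {a : Fin 3 → G} (ha : ∀ i, a i * a i = 1) {K : ℕ}
    (hinj : Function.Injective a) (h : NoShortRelation a (2 * (2 * K))) :
    Expands (boundary a) K where
  map_add := boundary_add a
  card_le := fun f hf => card_supp_le_boundary ha hinj h _ f rfl hf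

theorem covers_groupHyper {a : Fin 3 → G} (ha : ∀ i, a i * a i = 1)
    {K : ℕ} (hK : 1 ≤ K) : Elem.Covers (boundary a) K (groupHyper a) := by
  rintro t P hP _ _ _ ⟨h, π, rfl, rfl, rfl⟩ h0 h1 h2
  have hall : ∀ i, a i * h ∈ P := by
    intro i
    obtain ⟨j, rfl⟩ := π.surjective i
    fin_cases j <;> assumption
  -- The equation of one hyperedge is the consistency condition for a one-element set, which is
  -- where `1 ≤ K` enters.
  have := hP (Pi.single h 1) ?_ ?_
  · simp only [boundary_single ha, Finset.sum_mul, ite_mul, one_mul, zero_mul] at this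
    rw [Finset.sum_comm] at this
    simp only [Finset.sum_ite_eq', Finset.mem_univ, if_true] at this
    rw [← Equiv.sum_comp π, Fin.sum_univ_three] at this
    exact this
  · refine le_trans (Finset.card_le_card (t := {h}) fun s hs => ?_) hK
    rw [mem_supp, Pi.single_apply] at hs
    simpa using hs
  · intro s hs
    rw [mem_supp, boundary_single ha] at hs
    obtain ⟨i, -, hi⟩ := Finset.exists_ne_zero_of_sum_ne_zero hs
    have : s = a i * h := by by_contra h; simp [h] at hi
    rw [this]
    exact hall i

/-- By expansion, a small set of hyperedges with boundary inside `{s}` has at most one member; a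
single hyperedge has three boundary vertices, so the set is empty and imposes no condition. -/
theorem consistent_singleton {a : Fin 3 → G} (ha : ∀ i, a i * a i = 1) {K : ℕ}
    (hinj : Function.Injective a) (hd : Expands (boundary a) K) (t : G → ZMod 2) (s : G) :
    Consistent (boundary a) K t {s} := by
  intro f hf hs
  have h1 : (supp f).card ≤ 1 := (hd.card_le f (by omega)).trans (Finset.card_le_card hs)
  rcases Nat.le_one_iff_eq_zero_or_eq_one.1 h1 with h0 | h1
  · have : f = 0 := by
      funext r
      by_contra hr
      rw [Finset.card_eq_zero] at h0
      exact Finset.notMem_empty r (h0 ▸ mem_supp.2 hr)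
    subst this
    simp [boundary]
  · exfalso
    obtain ⟨h, hh⟩ := Finset.card_eq_one.1 h1
    have hfs : f = Pi.single h 1 := by
      funext r
      by_cases hr : r = h
      · subst hr
        rw [Pi.single_eq_same]
        exact zmod_two_eq_one (mem_supp.1 (hh ▸ Finset.mem_singleton_self r))
      · rw [Pi.single_eq_of_ne hr]
        by_contra h'
        have := mem_supp.2 h'
        rw [hh, Finset.mem_singleton] at this
        exact hr this
    have hmem : ∀ i, a i * h = s := by
      intro i
      refine Finset.mem_singleton.1 (hs (mem_supp.2 ?_))
      rw [hfs, boundary_single ha, Finset.sum_eq_single i]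
      · simp
      · intro j _ hj
        simp [hinj.eq_iff, hj.symm]
      · simp
    have := (hmem 0).trans (hmem 1).symm
    rw [mul_left_inj, hinj.eq_iff] at this
    exact absurd this (by decide)

end TwoGroup

/-- For every `K` there is an odd 4-multipede with two feet of one segment that cannot be
distinguished by consistent twists of size `K`. -/
theorem exists_multipede (K : ℕ) (hK : 1 ≤ K) : ∃ (G : Type) (_ : Fintype G) (_ : DecidableEq G)
    (d : (G → ZMod 2) → G → ZMod 2) (H : G → G → G → Prop) (s : G),
    Expands d K ∧ Elem.Covers d K H ∧ (∀ t, Consistent d K t {s}) ∧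
    (letI := Elem.multipede.{w} H; IsOddFourMultipede (Elem.{w} G)) := by
  classical
  -- Expansion is needed for up to `2 * K` hyperedges, and a walk through that many reads two
  -- letters per step.
  obtain ⟨G, _, _, a, hG, ha, hrel⟩ := exists_twoGroup (2 * (2 * K))
  have := Fintype.ofFinite G
  have hrel' : NoShortRelation a (2 * (2 * K)) := hrel
  have hinj := hrel'.injective ha (by omega)
  have hd := expands_boundary ha hinj hrel'
  refine ⟨G, inferInstance, inferInstance, boundary a, groupHyper a, 1, hd,
    covers_groupHyper ha hK, fun t => consistent_singleton ha hinj hd t 1,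
    Elem.isOddFourMultipede (isTripleSystem_groupHyper hinj) fun f hf => ?_⟩
  exact eq_zero_of_sum_eq_zero hG fun g => hf _ _ _ ⟨g, 1, rfl, rfl, rfl⟩

-- All variables other than `x` share one value, so `s` is the only segment involved and the
-- constant twist 1 exchanges its feet.
open Elem in
theorem matches_swap {G : Type} [Fintype G] [DecidableEq G] {d : (G → ZMod 2) → G → ZMod 2} {K : ℕ}
    {s : G} (hs : ∀ t, Consistent d K t {s}) (W : Finset ℕ) (x : ℕ) :
    Matches.{w} d K ∅ W (fun _ => 1) (fun n => if n = x then foot s 0 else foot s 1)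
      (fun n => if n = x then foot s 1 else foot s 0) where
  consistent := by
    refine (hs _).mono ?_
    rw [Finset.empty_union]
    refine Finset.biUnion_subset.2 fun n _ => ?_
    dsimp only
    split_ifs <;> exact le_refl _
  twist_eq := by
    intro n _
    split_ifs
    · rfl
    · exact congrArg (foot s) (show (0 : ZMod 2) = 1 + 1 by decide)

theorem not_definesLinearOrder_infFormula (φ : InfFormula.{u} vocabulary) (hφ : φ.IsLInfC) :
    ¬ φ.DefinesLinearOrder IsOddFourMultipede.{w} := by
  rintro ⟨x, y, -, -, hlin⟩
  -- The summand 1 only guarantees a positive bound when the formula has no variables.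
  obtain ⟨G, _, _, d, H, s, hd, hc, hs, hodd⟩ := exists_multipede.{w} (hφ.toFinset.card + 1) (by omega)
  let inst := Elem.multipede.{w} H
  refine IsLinearOrderRelation.false_of_symm (hlin (Elem.{w} G) hodd) (a := Elem.foot s 0)
    (b := Elem.foot s 1) (by simp) ?_
  exact Elem.realize_infFormula_iff (W := hφ.toFinset) hd hc (by omega) φ
    (Set.Finite.coe_toFinset (s := φ.vars) hφ).ge _ _ _
    (matches_swap hs _ x)

theorem not_definesLinearOrder_fpFormula (φ : FPFormula vocabulary) :
    ¬ φ.DefinesLinearOrder IsOddFourMultipede.{w} := by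
  rintro ⟨x, y, -, -, -, hlin⟩
  obtain ⟨G, _, _, d, H, s, hd, hc, hs, hodd⟩ :=
    exists_multipede.{w} ((φ.fixDepth + 1) * φ.allVars.card + 1) (by omega)
  let inst := Elem.multipede.{w} H
  refine IsLinearOrderRelation.false_of_symm (hlin (Elem.{w} G) hodd) (a := Elem.foot s 0)
    (b := Elem.foot s 1) (by simp) ?_
  exact Elem.realize_fpFormula_iff (W := φ.allVars) hd hc φ subset_rfl ∅ _ _ _ _ _ (by simp)
    (matches_swap hs _ x) fun _ _ _ _ _ _ => Iff.rfl

end Multipede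

theorem theorem4p1 :
    FinitelyAxiomatizable.{w} Multipede.IsOddFourMultipede ∧
    (∀ (M : Type w) [Multipede.vocabulary.Structure M] [Finite M],
      Multipede.IsOddFourMultipede M → IsRigid Multipede.vocabulary M) ∧
    (∀ φ : InfFormula.{u} Multipede.vocabulary, φ.IsLInfC →
      ¬ φ.DefinesLinearOrder Multipede.IsOddFourMultipede.{w}) ∧
    (∀ φ : FPFormula Multipede.vocabulary,
      ¬ φ.DefinesLinearOrder Multipede.IsOddFourMultipede.{w}) :=
  ⟨Multipede.finitelyAxiomatizable_isOddFourMultipede, Multipede.isRigid_of_isOddFourMultipede,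
    Multipede.not_definesLinearOrder_infFormula, Multipede.not_definesLinearOrder_fpFormula⟩
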